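/- **Model.** Consider one major agent (index $0$) and $n$ minor agents $i\in N=\{1,\dots,n\}$ over the horizon $t=1,\dots,T$, $T\ge 1$. The stacked state $x(t)=\mathrm{vec}(x_0(t),\dots,x_n(t))$ and control $u(t)=\mathrm{vec}(u_0(t),\dots,u_n(t))$ satisfy $x(t+1)=Ax(t)+Bu(t)+w(t)$, where the only nonzero blocks of $A$ and $B$ are $A_{ii},A_{i0}$ and $B_{ii},B_{i0}$; minor agent $i$ has the output $y_i(t)=C_{ii}x_i(t)+v_i(t)$. The primitive random vectors $x_i(1)$, $w_i(t)$ ($0\le i\le n$) and $v_i(t)$ ($i\in N$), $1\le t\le T$, are independent and have zero mean and finite variance (they need not be Gaussian). The agents' information is $I_0(t)=\{x_0(1{:}t),u_0(1{:}t-1)\}$, which is also the common information $I^c(t)$, and $I_i(t)=\{x_0(1{:}t),y_i(1{:}t),u_0(1{:}t-1),u_i(1{:}t-1)\}$ for $i\in N$. An affine strategy $g$ is a family of affine control laws $u_i(t)=g_{i,t}(I_i(t))$, $0\le i\le n$, and its cost is $$J(g)=\mathbb E\Big[\sum_{t=1}^{T-1}\big(x(t)^{\top}Qx(t)+u(t)^{\top}Ru(t)\big)+x(T)^{\top}Q_Tx(T)\Big],$$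 where $Q,Q_T$ are symmetric positive semidefinite and $R$ is symmetric positive definite. **Splitting.** For a given strategy put $u^c(t)=\mathbb E[u(t)\mid I^c(t)]$ and $u^\ell(t)=u(t)-u^c(t)$. Let $x^c(1)=x^\ell(1)=0$, $x^s(1)=x(1)$, and $x^c(t+1)=Ax^c(t)+Bu^c(t)$, $x^\ell(t+1)=Ax^\ell(t)+Bu^\ell(t)$, $x^s(t+1)=Ax^s(t)+w(t)$. Let $z^c(t)=x^c(t)+x^s(t)$ and $z^\ell_i(t)=x^\ell_i(t)+x^s_i(t)$. Let $H_0(t)$ and $H_i(t)$ be the linear spans in $L^2$ of the components of $I_0(t)$ and $I_i(t)$. Write $\mathbb L[\,\cdot\mid H]$ for the componentwise orthogonal projection in $L^2$ onto $H$ (the linear least mean square estimate), and define $$\hat z^c(t)=\mathbb L[z^c(t)\mid H_0(t)],\qquad \hat z^\ell_i(t)=\mathbb L[z^\ell_i(t)\mid H_i(t)]-\mathbb L[z^\ell_i(t)\mid H_0(t)].$$ Thus $\hat z^\ell_i(t)$ is the projection of $z^\ell_i(t)$ onto the orthogonal complement of $H_0(t)$ in $H_i(t)$. **Gains.** Let $\mathcal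 R(P,A,B,Q,R)=Q+A^{\top}PA-A^{\top}PB(R+B^{\top}PB)^{-1}B^{\top}PA$ and $\mathcal G(P,A,B,R)=(R+B^{\top}PB)^{-1}B^{\top}PA$. Let $S^c(T)=Q_T$ and $S^\ell_i(T)=[Q_T]_{ii}$, and for $t=T-1,\dots,1$ let $S^c(t)=\mathcal R(S^c(t+1),A,B,Q,R)$, $S^\ell_i(t)=\mathcal R(S^\ell_i(t+1),A_{ii},B_{ii},Q_{ii},R_{ii})$, $L^c(t)=\mathcal G(S^c(t+1),A,B,R)$ and $L^\ell_i(t)=\mathcal G(S^\ell_i(t+1),A_{ii},B_{ii},R_{ii})$. **Theorem.** Every affine strategy has a finite cost, and there is an affine strategy that minimizes $J$ among all affine strategies. An affine strategy is a minimizer if and only if, under it, for all $t=1,\dots,T-1$, almost surely $$u^c(t)=-L^c(t)\,\hat z^c(t)\qquad\text{and}\qquad u^\ell_i(t)=-L^\ell_i(t)\,\hat z^\ell_i(t)\quad\text{for all } i\in N.$$ The minimizer is unique in the sense that any two minimizing affine strategies generate almost surely the same control actions $u(1),\dots,u(T-1)$. -/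

import Mathlib

open MeasureTheory ProbabilityTheory Matrix
open scoped ENNReal

noncomputable section

namespace MajorMinor

/-! Time is counted from `0`: the instants `1, …, T` of a problem with horizon `T ≥ 1` are written
`0, …, N` with `N = T - 1`.  Control actions are taken, and running costs incurred, at the
instants `t < N`; the terminal cost is incurred at `N`.
Agent `0 : Fin (n + 1)` is the major agent and `i.succ`, for `i : Fin n`, are the minor agents.
The stacked vector of a family of vectors `v i ∈ ℝ^(d i)` is indexed by `Σ i, Fin (d i)`. -/

/-- Index set of a stacked (block) vector with block sizes `d`. -/
abbrev Stacked {n : ℕ} (d : Fin (n + 1) → ℕ) : Type := Σ i : Fin (n + 1), Fin (d i)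

/-- The deterministic data of a linear quadratic system with one major and `n` minor agents. -/
structure Model (n : ℕ) where
  /-- number of decision instants (horizon minus one) -/
  N : ℕ
  /-- dimensions of the states -/
  dx : Fin (n + 1) → ℕ
  /-- dimensions of the controls -/
  du : Fin (n + 1) → ℕ
  /-- dimensions of the outputs of the minor agents -/
  dy : Fin n → ℕ
  A : Matrix (Stacked dx) (Stacked dx) ℝ
  B : Matrix (Stacked dx) (Stacked du) ℝ
  C : ∀ i : Fin n, Matrix (Fin (dy i)) (Fin (dx i.succ)) ℝ
  Q : Matrix (Stacked dx) (Stacked dx) ℝ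
  QT : Matrix (Stacked dx) (Stacked dx) ℝ
  R : Matrix (Stacked du) (Stacked du) ℝ
  /-- the only nonzero blocks of `A` are `A i i` and `A i 0` -/
  A_sparse : ∀ i j : Fin (n + 1), i ≠ j → j ≠ 0 → ∀ a b, A ⟨i, a⟩ ⟨j, b⟩ = 0
  /-- the only nonzero blocks of `B` are `B i i` and `B i 0` -/
  B_sparse : ∀ i j : Fin (n + 1), i ≠ j → j ≠ 0 → ∀ a b, B ⟨i, a⟩ ⟨j, b⟩ = 0
  Q_posSemidef : Q.PosSemidef
  QT_posSemidef : QT.PosSemidef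
  R_posDef : R.PosDef

variable {n : ℕ} {Ω : Type*}

/-- The `i`-th diagonal block of a block matrix. -/
def diagBlock {d e : Fin (n + 1) → ℕ} (M : Matrix (Stacked d) (Stacked e) ℝ) (i : Fin (n + 1)) :
    Matrix (Fin (d i)) (Fin (e i)) ℝ :=
  Matrix.of fun a b => M ⟨i, a⟩ ⟨i, b⟩

/-! ### Riccati recursions and gains -/

section Riccati

variable {X U : Type*} [Fintype X] [Fintype U] [DecidableEq U]

/-- `Q + Aᵀ P A - Aᵀ P B (R + Bᵀ P B)⁻¹ Bᵀ P A`. -/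
def riccati (P A : Matrix X X ℝ) (B : Matrix X U ℝ) (Q : Matrix X X ℝ) (R : Matrix U U ℝ) :
    Matrix X X ℝ :=
  Q + Aᵀ * P * A - Aᵀ * P * B * (R + Bᵀ * P * B)⁻¹ * Bᵀ * P * A

/-- `(R + Bᵀ P B)⁻¹ Bᵀ P A`. -/
def gain (P A : Matrix X X ℝ) (B : Matrix X U ℝ) (R : Matrix U U ℝ) : Matrix U X ℝ :=
  (R + Bᵀ * P * B)⁻¹ * Bᵀ * P * A

/-- Solution of the backward Riccati recursion with terminal value `QT`, as a function of the
number of steps to go. -/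
def riccatiSol (A : Matrix X X ℝ) (B : Matrix X U ℝ) (Q QT : Matrix X X ℝ) (R : Matrix U U ℝ) :
    ℕ → Matrix X X ℝ
  | 0 => QT
  | k + 1 => riccati (riccatiSol A B Q QT R k) A B Q R

end Riccati

namespace Model

variable (M : Model n)

/-- `S^c(t)` for `t ≤ N`; thus `S^c(N) = QT`. -/
def Sc (t : ℕ) : Matrix (Stacked M.dx) (Stacked M.dx) ℝ :=
  riccatiSol M.A M.B M.Q M.QT M.R (M.N - t)

/-- `S^ℓ_i(t)` for `t ≤ N`; thus `S^ℓ_i(N)` is the `i`-th diagonal block of `QT`. -/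
def Sl (i : Fin n) (t : ℕ) : Matrix (Fin (M.dx i.succ)) (Fin (M.dx i.succ)) ℝ :=
  riccatiSol (diagBlock M.A i.succ) (diagBlock M.B i.succ) (diagBlock M.Q i.succ)
    (diagBlock M.QT i.succ) (diagBlock M.R i.succ) (M.N - t)

/-- The gain `L^c(t)`, `t < N`. -/
def Lc (t : ℕ) : Matrix (Stacked M.du) (Stacked M.dx) ℝ :=
  gain (M.Sc (t + 1)) M.A M.B M.R

/-- The gain `L^ℓ_i(t)`, `t < N`. -/
def Ll (i : Fin n) (t : ℕ) : Matrix (Fin (M.du i.succ)) (Fin (M.dx i.succ)) ℝ :=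
  gain (M.Sl i (t + 1)) (diagBlock M.A i.succ) (diagBlock M.B i.succ) (diagBlock M.R i.succ)

end Model

/-! ### Primitive random variables -/

/-- The primitive random variables: initial states, process noises, observation noises. -/
structure Noise (M : Model n) (Ω : Type*) where
  init : ∀ i : Fin (n + 1), Ω → Fin (M.dx i) → ℝ
  w : ∀ i : Fin (n + 1), ℕ → Ω → Fin (M.dx i) → ℝ
  v : ∀ i : Fin n, ℕ → Ω → Fin (M.dy i) → ℝ

/-- Labels of the primitive random variables at the instants `0, …, N`. -/
inductive Primitive (n N : ℕ) : Type
  | init (i : Fin (n + 1))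
  | w (i : Fin (n + 1)) (t : Fin (N + 1))
  | v (i : Fin n) (t : Fin (N + 1))

/-- Dimension of a primitive random vector. -/
def Model.primDim (M : Model n) : Primitive n M.N → ℕ
  | .init i => M.dx i
  | .w i _ => M.dx i
  | .v i _ => M.dy i

/-- The family of all primitive random vectors. -/
def Noise.prim {M : Model n} (P : Noise M Ω) :
    (p : Primitive n M.N) → Ω → Fin (M.primDim p) → ℝ
  | .init i => P.init i
  | .w i t => P.w i t
  | .v i t => P.v i t

/-- The primitive random vectors are independent, have zero mean and finite variance. -/
structure Noise.Admissible {M : Model n} [MeasurableSpace Ω] (P : Noise M Ω) (μ : Measure Ω) :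
    Prop where
  measurable : ∀ p, Measurable (P.prim p)
  memLp_two : ∀ p a, MemLp (fun ω => P.prim p ω a) 2 μ
  mean_zero : ∀ p a, ∫ ω, P.prim p ω a ∂μ = 0
  indep : iIndepFun P.prim μ

/-- The stacked initial state. -/
def Noise.x₁ {M : Model n} (P : Noise M Ω) (ω : Ω) : Stacked M.dx → ℝ :=
  fun p => P.init p.1 ω p.2

/-- The stacked process noise `w(t)`. -/
def Noise.W {M : Model n} (P : Noise M Ω) (t : ℕ) (ω : Ω) : Stacked M.dx → ℝ :=
  fun p => P.w p.1 t ω p.2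

/-! ### Dynamics, information and affine strategies -/

/-- A control process: `u t ω` is the stacked vector of the control actions at time `t`. -/
abbrev Control (M : Model n) (Ω : Type*) : Type _ := ℕ → Ω → Stacked M.du → ℝ

/-- Scalar coordinates of `I_0(t) = (x_0(0:t), u_0(0:t-1))`. -/
abbrev Model.MajorIdx (M : Model n) (t : ℕ) : Type :=
  (Fin (t + 1) × Fin (M.dx 0)) ⊕ (Fin t × Fin (M.du 0))

/-- Scalar coordinates of `I_i(t) = (x_0(0:t), u_0(0:t-1), y_i(0:t), u_i(0:t-1))`. -/
abbrev Model.MinorIdx (M : Model n) (i : Fin n) (t : ℕ) : Type :=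
  M.MajorIdx t ⊕ ((Fin (t + 1) × Fin (M.dy i)) ⊕ (Fin t × Fin (M.du i.succ)))

section Dynamics

variable {M : Model n} (P : Noise M Ω) (u : Control M Ω)

/-- The state: `x(t+1) = A x(t) + B u(t) + w(t)`. -/
def state : ℕ → Ω → Stacked M.dx → ℝ
  | 0, ω => P.x₁ ω
  | t + 1, ω => M.A *ᵥ state t ω + M.B *ᵥ u t ω + P.W t ω

/-- The output `y_i(t) = C_ii x_i(t) + v_i(t)` of a minor agent. -/
def output (i : Fin n) (t : ℕ) (ω : Ω) : Fin (M.dy i) → ℝ :=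
  M.C i *ᵥ (fun a => state P u t ω ⟨i.succ, a⟩) + P.v i t ω

/-- `I_0(t)`, which is also the common information `I^c(t)`. -/
def majorInfo (t : ℕ) (ω : Ω) : M.MajorIdx t → ℝ :=
  Sum.elim (fun p => state P u p.1 ω ⟨0, p.2⟩) (fun p => u p.1 ω ⟨0, p.2⟩)

/-- `I_i(t)` for a minor agent. -/
def minorInfo (i : Fin n) (t : ℕ) (ω : Ω) : M.MinorIdx i t → ℝ :=
  Sum.elim (majorInfo P u t ω)
    (Sum.elim (fun p => output P u i p.1 ω p.2) (fun p => u p.1 ω ⟨i.succ, p.2⟩))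

end Dynamics

/-- An affine strategy: control laws `g_{i,t}` that are affine functions of `I_i(t)`.
Only those at the instants `t < N` influence the cost. -/
structure AffineStrategy (M : Model n) where
  major : ∀ t, (M.MajorIdx t → ℝ) →ᵃ[ℝ] (Fin (M.du 0) → ℝ)
  minor : ∀ (i : Fin n) (t), (M.MinorIdx i t → ℝ) →ᵃ[ℝ] (Fin (M.du i.succ) → ℝ)

namespace AffineStrategy

variable {M : Model n} (g : AffineStrategy M) (P : Noise M Ω)

/-- The actions prescribed by `g` at time `t` when the controls used so far are `u`. -/
def act (u : Control M Ω) (t : ℕ) (ω : Ω) : Stacked M.du → ℝ := fun p =>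
  Fin.cases (motive := fun j => Fin (M.du j) → ℝ) (g.major t (majorInfo P u t ω))
    (fun i => g.minor i t (minorInfo P u i t ω)) p.1 p.2

/-- Controls generated by `g` at the instants `< t` (and `0` from time `t` on). -/
def controlUpTo : ℕ → Control M Ω
  | 0 => 0
  | t + 1 => Function.update (controlUpTo t) t (g.act P (controlUpTo t) t)

/-- The closed-loop control process generated by `g`. -/
def control : Control M Ω := fun t => g.controlUpTo P (t + 1) t

end AffineStrategy

theorem state_congr {M : Model n} (P : Noise M Ω) {u u' : Control M Ω} {t : ℕ}
    (h : ∀ s < t, u s = u' s) : state P u t = state P u' t := by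
  induction t with
  | zero => rfl
  | succ t ih =>
    funext ω
    simp only [state]
    rw [ih fun s hs => h s (by omega), h t (by omega)]

/-- The closed loop satisfies `u_i(t) = g_{i,t}(I_i(t))`, with the information generated by the
closed loop itself. -/
theorem AffineStrategy.control_eq {M : Model n} (g : AffineStrategy M) (P : Noise M Ω) (t : ℕ) :
    g.control P t = g.act P (g.control P) t := by
  have hist : ∀ t s, s < t → g.controlUpTo P t s = g.control P s := by
    intro t
    induction t with
    | zero => intro s hs; omega
    | succ t ih =>
      intro s hs
      rcases Nat.lt_succ_iff_lt_or_eq.mp hs with h | rfl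
      · rw [controlUpTo, Function.update_of_ne h.ne, ih s h]
      · rfl
  have h1 : g.control P t = g.act P (g.controlUpTo P t) t := by
    simp [control, controlUpTo]
  have hst : ∀ s : Fin (t + 1), state P (g.controlUpTo P t) s = state P (g.control P) s :=
    fun s => state_congr P fun r hr => hist t r (by omega)
  have hu : ∀ s : Fin t, g.controlUpTo P t s = g.control P s := fun s => hist t s s.2
  rw [h1]
  funext ω p
  simp only [act, minorInfo, majorInfo, output, hst, hu]

section Cost

variable {M : Model n}

/-- The total cost incurred along the sample path `ω`. -/
def pathCost (P : Noise M Ω) (u : Control M Ω) (ω : Ω) : ℝ :=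
  ∑ t ∈ Finset.range M.N,
      (state P u t ω ⬝ᵥ M.Q *ᵥ state P u t ω + u t ω ⬝ᵥ M.R *ᵥ u t ω) +
    state P u M.N ω ⬝ᵥ M.QT *ᵥ state P u M.N ω

variable [MeasurableSpace Ω]

/-- The performance `J(g)`. -/
def AffineStrategy.cost (g : AffineStrategy M) (P : Noise M Ω) (μ : Measure Ω) : ℝ :=
  ∫ ω, pathCost P (g.control P) ω ∂μ

/-- `g` minimizes the expected cost among all affine strategies. -/
def AffineStrategy.IsOptimal (g : AffineStrategy M) (P : Noise M Ω) (μ : Measure Ω) : Prop :=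
  ∀ g' : AffineStrategy M, g.cost P μ ≤ g'.cost P μ

end Cost

/-! ### Splitting of controls and states -/

section Split

variable {M : Model n} [MeasurableSpace Ω] (P : Noise M Ω) (μ : Measure Ω) (u : Control M Ω)

/-- `u^c(t) = E[u(t) | I^c(t)]`, coordinate by coordinate. -/
def commonControl : Control M Ω := fun t ω p =>
  (μ[fun ω' => u t ω' p | MeasurableSpace.comap (majorInfo P u t) inferInstance]) ω

/-- `u^ℓ(t) = u(t) - u^c(t)`. -/
def localControl : Control M Ω := fun t ω => u t ω - commonControl P μ u t ω

/-- `x^c`. -/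
def commonState : ℕ → Ω → Stacked M.dx → ℝ
  | 0, _ => 0
  | t + 1, ω => M.A *ᵥ commonState t ω + M.B *ᵥ commonControl P μ u t ω

/-- `x^ℓ`. -/
def localState : ℕ → Ω → Stacked M.dx → ℝ
  | 0, _ => 0
  | t + 1, ω => M.A *ᵥ localState t ω + M.B *ᵥ localControl P μ u t ω

/-- `x^s`. -/
def stochState : ℕ → Ω → Stacked M.dx → ℝ
  | 0, ω => P.x₁ ω
  | t + 1, ω => M.A *ᵥ stochState t ω + P.W t ω

/-- `z^c(t) = x^c(t) + x^s(t)`. -/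
def zc (t : ℕ) (ω : Ω) : Stacked M.dx → ℝ :=
  commonState P μ u t ω + stochState P t ω

/-- `z^ℓ_i(t) = x^ℓ_i(t) + x^s_i(t)`. -/
def zl (i : Fin n) (t : ℕ) (ω : Ω) : Fin (M.dx i.succ) → ℝ := fun a =>
  localState P μ u t ω ⟨i.succ, a⟩ + stochState P t ω ⟨i.succ, a⟩

end Split

/-! ### Linear least mean square estimates -/

section LLMS

variable [MeasurableSpace Ω] (μ : Measure Ω)

open Classical in
/-- The class in `L²(μ)` of a real random variable.  Every random variable to which this is applied
below is square integrable when the control process comes from an affine strategy; the default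
value `0` only makes the function total. -/
def toL2 (f : Ω → ℝ) : Lp ℝ 2 μ := if h : MemLp f 2 μ then h.toLp f else 0

/-- The span in `L²(μ)` of finitely many real random variables. -/
def spanL2 {ι : Type*} (f : Ω → ι → ℝ) : Submodule ℝ (Lp ℝ 2 μ) :=
  Submodule.span ℝ (Set.range fun k => toL2 μ fun ω => f ω k)

instance {ι : Type*} [Finite ι] (f : Ω → ι → ℝ) : FiniteDimensional ℝ (spanL2 μ f) :=
  FiniteDimensional.span_of_finite ℝ (Set.finite_range _)

/-- The LLMS estimate of `f` given `H`: the orthogonal projection of `f` onto `H`. -/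
def llms (H : Submodule ℝ (Lp ℝ 2 μ)) [H.HasOrthogonalProjection] (f : Ω → ℝ) : Lp ℝ 2 μ :=
  H.starProjection (toL2 μ f)

variable {M : Model n} (P : Noise M Ω) (u : Control M Ω)

/-- `H_0(t) = span I_0(t)`. -/
abbrev H0 (t : ℕ) : Submodule ℝ (Lp ℝ 2 μ) := spanL2 μ (majorInfo P u t)

/-- `H_i(t) = span I_i(t)`. -/
abbrev Hi (i : Fin n) (t : ℕ) : Submodule ℝ (Lp ℝ 2 μ) := spanL2 μ (minorInfo P u i t)

/-- The orthogonal complement of `H_0(t)` within `H_i(t)`. -/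
abbrev Htilde (i : Fin n) (t : ℕ) : Submodule ℝ (Lp ℝ 2 μ) := (H0 μ P u t)ᗮ ⊓ Hi μ P u i t

/-- `ẑ^c(t) = 𝕃[z^c(t) | H_0(t)]`, coordinate by coordinate. -/
def zcHat (t : ℕ) (ω : Ω) : Stacked M.dx → ℝ := fun p =>
  llms μ (H0 μ P u t) (fun ω' => zc P μ u t ω' p) ω

/-- `ẑ^ℓ_i(t) = 𝕃[z^ℓ_i(t) | H_i(t)] - 𝕃[z^ℓ_i(t) | H_0(t)]`, coordinate by coordinate. -/
def zlHat (i : Fin n) (t : ℕ) (ω : Ω) : Fin (M.dx i.succ) → ℝ := fun a =>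
  llms μ (Hi μ P u i t) (fun ω' => zl P μ u i t ω' a) ω -
    llms μ (H0 μ P u t) (fun ω' => zl P μ u i t ω' a) ω

theorem H0_le_Hi (i : Fin n) (t : ℕ) : H0 μ P u t ≤ Hi μ P u i t := by
  refine Submodule.span_mono ?_
  rintro _ ⟨k, rfl⟩
  exact ⟨Sum.inl k, rfl⟩

/-- `ẑ^ℓ_i(t)` is the projection of `z^ℓ_i(t)` onto the orthogonal complement of `H_0(t)` within
`H_i(t)`. -/
theorem zlHat_ae_eq (i : Fin n) (t : ℕ) (a : Fin (M.dx i.succ)) :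
    (fun ω => zlHat μ P u i t ω a) =ᵐ[μ]
      llms μ (Htilde μ P u i t) (fun ω' => zl P μ u i t ω' a) := by
  have key : llms μ (Htilde μ P u i t) (fun ω' => zl P μ u i t ω' a) =
      llms μ (Hi μ P u i t) (fun ω' => zl P μ u i t ω' a) -
        llms μ (H0 μ P u t) (fun ω' => zl P μ u i t ω' a) := by
    unfold llms
    generalize toL2 μ (fun ω' => zl P μ u i t ω' a) = f
    have hle := H0_le_Hi μ P u i t
    refine (Submodule.eq_starProjection_of_mem_orthogonal (K := Htilde μ P u i t) ?_ ?_)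
    · refine Submodule.mem_inf.mpr ⟨?_, ?_⟩
      · have h1 := Submodule.sub_starProjection_mem_orthogonal (K := Hi μ P u i t) f
        have h2 := Submodule.sub_starProjection_mem_orthogonal (K := H0 μ P u t) f
        have h3 := Submodule.sub_mem _ h2 (Submodule.orthogonal_le hle h1)
        convert h3 using 1
        abel
      · exact Submodule.sub_mem _ (Submodule.starProjection_apply_mem _ _)
          (hle (Submodule.starProjection_apply_mem _ _))
    · have h1 := Submodule.sub_starProjection_mem_orthogonal (K := Hi μ P u i t) f
      have h1' := Submodule.orthogonal_le (inf_le_right : Htilde μ P u i t ≤ _) h1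
      have h2 : (H0 μ P u t).starProjection f ∈ (Htilde μ P u i t)ᗮ :=
        Submodule.orthogonal_le inf_le_left
          (Submodule.le_orthogonal_orthogonal _ (Submodule.starProjection_apply_mem _ _))
      have h3 := Submodule.add_mem _ h1' h2
      convert h3 using 1
      abel
  rw [key]
  filter_upwards [Lp.coeFn_sub (llms μ (Hi μ P u i t) (fun ω' => zl P μ u i t ω' a))
    (llms μ (H0 μ P u t) (fun ω' => zl P μ u i t ω' a))] with ω hω
  rw [hω]
  rfl

end LLMS

/-- At every decision instant, almost surely,
`u^c(t) = -L^c(t) ẑ^c(t)` and `u^ℓ_i(t) = -L^ℓ_i(t) ẑ^ℓ_i(t)` for every minor agent `i`. -/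
def AffineStrategy.HasGainForm {M : Model n} [MeasurableSpace Ω] (g : AffineStrategy M)
    (P : Noise M Ω) (μ : Measure Ω) : Prop :=
  ∀ t < M.N,
    (∀ᵐ ω ∂μ, commonControl P μ (g.control P) t ω =
      -(M.Lc t *ᵥ zcHat μ P (g.control P) t ω)) ∧
    ∀ i : Fin n, ∀ᵐ ω ∂μ, (fun a => localControl P μ (g.control P) t ω ⟨i.succ, a⟩) =
      -(M.Ll i t *ᵥ zlHat μ P (g.control P) i t ω)

end MajorMinor

end

/-! All random vectors are regarded as tuples of elements of $L^2$. The expected cost is then a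
quadratic form in the classes of the states and controls, and the information constraints have to
become fixed subspaces.

They do, because the controls can be subtracted from the information. By sparsity the major agent's
state is driven only by itself, $u_0$ and $w_0$, so the affine functions of $I_0(t)$ are the span
`commonSpace` of $1$, $x_0(1)$ and the past $w_0(s)$. A minor state differs from its uncontrolled
version `freeState` only by signals that agent $i$ knows. Hence the affine functions of $I_i(t)$ are
`commonSpace` plus the span `localSpace` of the control-free outputs up to time $t$. Conversely
these control-free variables are linear in the information with coefficients independent of the
control, so every process with entries in these spaces comes from an affine strategy
(`exists_strategy`).

Independence and zero means make `commonSpace` and the spaces of the different minor agents mutually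
orthogonal. Splitting states and controls along the projection onto `commonSpace` therefore
decouples the cost into one problem with the full matrices and one problem per minor agent with the
diagonal blocks (`IsTrajectory.quadCost_split`). In each of them the controls lie in an increasing
family $H_t$ and the noise at time $t$ is orthogonal to $H_t$. The estimation error $x-\mathbb
P_{H_t}x$ is free of the control, so completing squares gives a constant plus positive definite
forms in $u+L\,\mathbb P_{H_t}x$ (`quadCost_eq`). The optimal strategies are those whose residuals
all vanish. Such a strategy exists (`exists_isFeedback`), and the feedback recursion determines its
controls almost surely.

Two gaps remain to the stated formulas. First, $\mathbb E[\,\cdot\mid I^c(t)]$ is an orthogonal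
projection onto `commonSpace` without any Gaussian assumption, because the local part of a control
is independent of $I^c(t)$ and has zero mean (`condExp_add_minorPrim`). Second, $H_0(t)$ and
$H_i(t)$ are linear spans without constants and depend on the offsets of the strategy. Induction
over time removes this dependence: if the feedback is optimal before $t$, all information at $t$ has
zero mean, the spans are the mean-zero parts of the fixed spaces (`H0_eq`, `Hi_eq`), and the gain
form at $t$ is equivalent to the optimal feedback at $t$ (`gainForm_iff`). -/

noncomputable section

set_option linter.unusedSectionVars false

namespace MajorMinor

/-! ### Matrices acting on vectors with entries in a vector space -/

section VectorAction

variable {V V' : Type*} [AddCommGroup V] [Module ℝ V] [AddCommGroup V'] [Module ℝ V']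
variable {E : Type*} [NormedAddCommGroup E] [InnerProductSpace ℝ E]
variable {a b c : Type*} [Fintype a] [Fintype b] [Fintype c]

/-- The action of a real matrix on a vector with entries in a real vector space. -/
def act (M : Matrix a b ℝ) (x : b → V) : a → V := fun i => ∑ j, M i j • x j

theorem act_add (M : Matrix a b ℝ) (x y : b → V) : act M (x + y) = act M x + act M y := by
  funext i; simp [act, smul_add, Finset.sum_add_distrib]

theorem act_sub (M : Matrix a b ℝ) (x y : b → V) : act M (x - y) = act M x - act M y := by
  funext i; simp [act, smul_sub, Finset.sum_sub_distrib]

theorem add_act (M N : Matrix a b ℝ) (x : b → V) : act (M + N) x = act M x + act N x := by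
  funext i; simp [act, add_smul, Finset.sum_add_distrib]

theorem sub_act (M N : Matrix a b ℝ) (x : b → V) : act (M - N) x = act M x - act N x := by
  funext i; simp [act, sub_smul, Finset.sum_sub_distrib]

theorem one_act [DecidableEq a] (x : a → V) : act (1 : Matrix a a ℝ) x = x := by
  funext i; simp [act, Matrix.one_apply, ite_smul]

theorem act_act (M : Matrix a b ℝ) (N : Matrix b c ℝ) (x : c → V) :
    act M (act N x) = act (M * N) x := by
  funext i
  simp only [act, Matrix.mul_apply, Finset.sum_smul, Finset.smul_sum, smul_smul]
  exact Finset.sum_comm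

theorem act_real (M : Matrix a b ℝ) (x : b → ℝ) : act M x = M *ᵥ x := by
  funext i; simp [act, Matrix.mulVec, dotProduct]

theorem map_act (f : V →ₗ[ℝ] V')
    (M : Matrix a b ℝ) (x : b → V) (i : a) : f (act M x i) = act M (fun j => f (x j)) i := by
  simp [act]

theorem act_mem {K : Submodule ℝ V} (M : Matrix a b ℝ) {x : b → V} (hx : ∀ j, x j ∈ K) (i : a) :
    act M x i ∈ K :=
  K.sum_mem fun j _ => K.smul_mem _ (hx j)

/-- The sum of the entrywise inner products. -/
def ip (x y : a → E) : ℝ := ∑ i, inner ℝ (x i) (y i)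

theorem ip_add_left (x y z : a → E) : ip (x + y) z = ip x z + ip y z := by
  simp [ip, inner_add_left, Finset.sum_add_distrib]

theorem ip_add_right (x y z : a → E) : ip x (y + z) = ip x y + ip x z := by
  simp [ip, inner_add_right, Finset.sum_add_distrib]

theorem ip_sub_right (x y z : a → E) : ip x (y - z) = ip x y - ip x z := by
  simp [ip, inner_sub_right, Finset.sum_sub_distrib]

theorem ip_comm (x y : a → E) : ip x y = ip y x := by
  simp only [ip]; exact Finset.sum_congr rfl fun i _ => real_inner_comm _ _

theorem ip_act_left (M : Matrix a b ℝ) (x : b → E) (y : a → E) :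
    ip (act M x) y = ip x (act Mᵀ y) := by
  simp only [ip, act, sum_inner, inner_sum, inner_smul_left, inner_smul_right,
    Matrix.transpose_apply]
  exact Finset.sum_comm

theorem ip_eq_zero_of_orthogonal {V : Submodule ℝ E} {x y : a → E} (hx : ∀ i, x i ∈ V)
    (hy : ∀ i, y i ∈ Vᗮ) : ip x y = 0 :=
  Finset.sum_eq_zero fun i _ => Submodule.inner_right_of_mem_orthogonal (hx i) (hy i)

theorem ip_self_nonneg (x : a → E) : 0 ≤ ip x x :=
  Finset.sum_nonneg fun _ _ => real_inner_self_nonneg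

theorem eq_zero_of_ip_self {x : a → E} (h : ip x x = 0) : x = 0 := by
  have := (Finset.sum_eq_zero_iff_of_nonneg fun i _ => real_inner_self_nonneg).1 h
  funext i
  exact inner_self_eq_zero.1 (this i (Finset.mem_univ i))

theorem ip_act_symm {S : Matrix a a ℝ} (hS : Sᵀ = S) (x y : a → E) :
    ip x (act S y) = ip y (act S x) := by
  rw [ip_comm, ip_act_left, hS]

-- `Matrix.PosSemidef` concerns vectors of scalars. Writing $S=D^\top D$ transfers positivity to
-- vectors with entries in an inner product space, where the form becomes a sum of squared norms.
open scoped MatrixOrder in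
theorem exists_eq_transpose_mul_self {S : Matrix a a ℝ} (hS : S.PosSemidef) :
    ∃ D : Matrix a a ℝ, S = Dᵀ * D := by
  classical
  obtain ⟨D, hD⟩ := CStarAlgebra.nonneg_iff_eq_star_mul_self.mp hS.nonneg
  refine ⟨D, ?_⟩
  rw [hD, Matrix.star_eq_conjTranspose, Matrix.conjTranspose_eq_transpose_of_trivial]

theorem quad_nonneg {S : Matrix a a ℝ} (hS : S.PosSemidef) (x : a → E) :
    0 ≤ ip x (act S x) := by
  obtain ⟨D, rfl⟩ := exists_eq_transpose_mul_self hS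
  rw [← act_act, ← ip_act_left]
  exact ip_self_nonneg _

/-- With $S=D^\top D$ the hypothesis forces $Dx=0$, hence $Sx=0$, and $S$ is invertible. -/
theorem eq_zero_of_quad {S : Matrix a a ℝ} (hS : S.PosDef) {x : a → E}
    (h : ip x (act S x) = 0) : x = 0 := by
  classical
  obtain ⟨D, hD⟩ := exists_eq_transpose_mul_self hS.posSemidef
  have h1 : act D x = 0 := by
    apply eq_zero_of_ip_self
    rw [ip_act_left, act_act, ← hD, h]
  have h2 : act S x = 0 := by
    rw [hD, ← act_act, h1]; funext i; simp [act]
  have hu : IsUnit S.det := hS.det_pos.ne'.isUnit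
  rw [← one_act x, ← Matrix.nonsing_inv_mul S hu, ← act_act, h2]
  funext i; simp [act]

end VectorAction

/-! ### Completion of squares -/

section Completion

variable {E : Type*} [NormedAddCommGroup E] [InnerProductSpace ℝ E]
variable {X U : Type*} [Fintype X] [Fintype U] [DecidableEq U]

theorem transpose_eq_of_posSemidef {S : Matrix X X ℝ} (hS : S.PosSemidef) : Sᵀ = S := by
  rw [← Matrix.conjTranspose_eq_transpose_of_trivial]; exact hS.1

theorem posDef_innovation {S : Matrix X X ℝ} (hS : S.PosSemidef) (B : Matrix X U ℝ)
    {R : Matrix U U ℝ} (hR : R.PosDef) : (R + Bᵀ * S * B).PosDef := by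
  refine hR.add_posSemidef ?_
  rw [← Matrix.conjTranspose_eq_transpose_of_trivial]
  exact hS.conjTranspose_mul_mul_same B

/-- One step of the completion of squares. -/
theorem completion_step {S : Matrix X X ℝ} (hS : S.PosSemidef) (A : Matrix X X ℝ)
    (B : Matrix X U ℝ) (Q : Matrix X X ℝ) {R : Matrix U U ℝ} (hR : R.PosDef)
    (x w : X → E) (u : U → E) :
    ip x (act Q x) + ip u (act R u) +
        ip (act A x + act B u + w) (act S (act A x + act B u + w)) =
      ip x (act (riccati S A B Q R) x) +
        ip (u + act (gain S A B R) x) (act (R + Bᵀ * S * B) (u + act (gain S A B R) x)) +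
        (2 * ip w (act S (act A x + act B u)) + ip w (act S w)) := by
  have hG := posDef_innovation hS B hR
  have hSt := transpose_eq_of_posSemidef hS
  have hGt := transpose_eq_of_posSemidef hG.posSemidef
  have hu : IsUnit (R + Bᵀ * S * B).det := hG.det_pos.ne'.isUnit
  set G := R + Bᵀ * S * B with hGdef
  have hGL : G * gain S A B R = Bᵀ * S * A := by
    rw [gain, ← hGdef]
    simp only [Matrix.mul_assoc]
    rw [Matrix.mul_nonsing_inv_cancel_left _ _ hu]
  have hLt : (gain S A B R)ᵀ = Aᵀ * S * B * G⁻¹ := by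
    rw [gain, ← hGdef]
    simp only [Matrix.transpose_mul, Matrix.transpose_transpose, Matrix.transpose_nonsing_inv, hGt,
      hSt, Matrix.mul_assoc]
  -- Since $GL=B^\top SA$, the subtracted term is $L^\top GL$, which is what completing the square
  -- in $u+Lx$ requires. The inverse no longer appears from here on.
  have hric : riccati S A B Q R = Q + Aᵀ * S * A - (gain S A B R)ᵀ * (Bᵀ * S * A) := by
    rw [hLt, riccati, ← hGdef]; simp only [Matrix.mul_assoc]
  set L := gain S A B R with hL
  have e1 : ip x (act (Aᵀ * S * A) x) = ip (act A x) (act S (act A x)) := by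
    rw [ip_act_left, act_act, act_act, Matrix.mul_assoc]
  have e2 : ip x (act (Lᵀ * (Bᵀ * S * A)) x) = ip (act L x) (act G (act L x)) := by
    rw [ip_act_left, act_act, act_act, ← hGL, Matrix.mul_assoc]
  have e3 : ip u (act G (act L x)) = ip (act B u) (act S (act A x)) := by
    rw [act_act, hGL, ip_act_left, act_act, act_act, Matrix.mul_assoc]
  have e4 : ip u (act G u) = ip u (act R u) + ip (act B u) (act S (act B u)) := by
    rw [hGdef, add_act, ip_add_right, ip_act_left, act_act, act_act, Matrix.mul_assoc]
  rw [hric, sub_act, add_act, ip_sub_right, ip_add_right, e1, e2]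
  simp only [act_add, ip_add_left, ip_add_right]
  rw [ip_act_symm hGt (act L x) u, e3, e4, ip_act_symm hSt (act A x) (act B u),
    ip_act_symm hSt (act A x) w, ip_act_symm hSt (act B u) w]
  ring

theorem posSemidef_riccati {S : Matrix X X ℝ} (hS : S.PosSemidef) (A : Matrix X X ℝ)
    (B : Matrix X U ℝ) {Q : Matrix X X ℝ} (hQ : Q.PosSemidef) {R : Matrix U U ℝ}
    (hR : R.PosDef) : (riccati S A B Q R).PosSemidef := by
  have hSt := transpose_eq_of_posSemidef hS
  have hGt := transpose_eq_of_posSemidef (posDef_innovation hS B hR).posSemidef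
  refine Matrix.PosSemidef.of_dotProduct_mulVec_nonneg ?_ fun x => ?_
  · rw [Matrix.IsHermitian, Matrix.conjTranspose_eq_transpose_of_trivial, riccati]
    simp only [Matrix.transpose_sub, Matrix.transpose_add, Matrix.transpose_mul,
      Matrix.transpose_transpose, Matrix.transpose_nonsing_inv, hSt,
      transpose_eq_of_posSemidef hQ, transpose_eq_of_posSemidef hR.posSemidef, Matrix.mul_assoc]
  -- For scalar entries, zero noise and $u=-Lx$ the square vanishes, so the Riccati form equals the
  -- one-step cost of that control, which is nonnegative.
  · have h := completion_step (E := ℝ) hS A B Q hR x 0 (-act (gain S A B R) x)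
    have h1 := quad_nonneg hQ x
    have h2 := quad_nonneg hR.posSemidef (-act (gain S A B R) x)
    have h3 := quad_nonneg hS (act A x + act B (-act (gain S A B R) x) + 0)
    have h4 : star x ⬝ᵥ riccati S A B Q R *ᵥ x = ip x (act (riccati S A B Q R) x) := by
      rw [act_real]; simp [ip, dotProduct, mul_comm]
    rw [h4]
    simp [ip, act] at h h1 h2 h3 ⊢
    linarith

theorem posSemidef_riccatiSol (A : Matrix X X ℝ) (B : Matrix X U ℝ) {Q QT : Matrix X X ℝ}
    (hQ : Q.PosSemidef) (hQT : QT.PosSemidef) {R : Matrix U U ℝ} (hR : R.PosDef) (k : ℕ) :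
    (riccatiSol A B Q QT R k).PosSemidef := by
  induction k with
  | zero => exact hQT
  | succ k ih => exact posSemidef_riccati ih A B hQ hR

/-- The uncontrolled state process. -/
def freeEvolution (A : Matrix X X ℝ) (x₀ : X → E) (w : ℕ → X → E) : ℕ → X → E
  | 0 => x₀
  | t + 1 => act A (freeEvolution A x₀ w t) + w t

/-- The quadratic cost of a state and a control process over the horizon `N`. -/
def quadCost (N : ℕ) (Q QT : Matrix X X ℝ) (R : Matrix U U ℝ) (x : ℕ → X → E) (u : ℕ → U → E) :
    ℝ :=
  ∑ t ∈ Finset.range N, (ip (x t) (act Q (x t)) + ip (u t) (act R (u t))) +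
    ip (x N) (act QT (x N))

/-- There is no dual effect: past controls move the state only within the current information space,
so they cannot alter the estimation error. -/
theorem sub_freeEvolution_mem {N : ℕ} {A : Matrix X X ℝ} {B : Matrix X U ℝ} {x₀ : X → E}
    {w : ℕ → X → E} {H : ℕ → Submodule ℝ E} (hH : Monotone H) {x : ℕ → X → E} {u : ℕ → U → E}
    (h0 : x 0 = x₀) (hx : ∀ t < N, x (t + 1) = act A (x t) + act B (u t) + w t)
    (hu : ∀ t < N, ∀ i, u t i ∈ H t) {t : ℕ} (ht : t ≤ N) (i : X) :
    x t i - freeEvolution A x₀ w t i ∈ H t := by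
  induction t generalizing i with
  | zero => simp [freeEvolution, h0]
  | succ t ih =>
    have : x (t + 1) i - freeEvolution A x₀ w (t + 1) i =
        act A (x t - freeEvolution A x₀ w t) i + act B (u t) i := by
      rw [hx t (by omega), freeEvolution, act_sub]
      simp only [Pi.add_apply, Pi.sub_apply]; abel
    rw [this]
    exact hH t.le_succ (add_mem (act_mem A (fun j => ih (by omega) j) i)
      (act_mem B (hu t (by omega)) i))

/-- Completion of squares for the linear quadratic problem in which the control at time `t` has
entries in `H t` and the noise at time `t` is orthogonal to `H t`. -/
theorem quadCost_eq (N : ℕ) (A : Matrix X X ℝ) (B : Matrix X U ℝ) {Q QT : Matrix X X ℝ}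
    (hQ : Q.PosSemidef) (hQT : QT.PosSemidef) {R : Matrix U U ℝ} (hR : R.PosDef)
    (x₀ : X → E) (w : ℕ → X → E) (H : ℕ → Submodule ℝ E) [∀ t, (H t).HasOrthogonalProjection]
    (hH : Monotone H) (hw : ∀ t < N, ∀ i, w t i ∈ (H t)ᗮ) :
    ∃ c : ℝ, ∀ (x : ℕ → X → E) (u : ℕ → U → E), x 0 = x₀ →
      (∀ t < N, x (t + 1) = act A (x t) + act B (u t) + w t) →
      (∀ t < N, ∀ i, u t i ∈ H t) →
      quadCost N Q QT R x u = c + ∑ t ∈ Finset.range N,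
        ip (u t + act (gain (riccatiSol A B Q QT R (N - (t + 1))) A B R)
            fun i => (H t).starProjection (x t i))
          (act (R + Bᵀ * riccatiSol A B Q QT R (N - (t + 1)) * B)
            (u t + act (gain (riccatiSol A B Q QT R (N - (t + 1))) A B R)
              fun i => (H t).starProjection (x t i))) := by
  set S : ℕ → Matrix X X ℝ := fun t => riccatiSol A B Q QT R (N - t) with hSdef
  set ξ := freeEvolution A x₀ w with hξ
  set L : ℕ → Matrix U X ℝ := fun t => gain (S (t + 1)) A B R with hLdef
  set G : ℕ → Matrix U U ℝ := fun t => R + Bᵀ * S (t + 1) * B with hGdef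
  set e : ℕ → X → E := fun t i => ξ t i - (H t).starProjection (ξ t i) with hedef
  have hSpos : ∀ t, (S t).PosSemidef := fun t => posSemidef_riccatiSol A B hQ hQT hR _
  -- The constant collects the initial term, the estimation errors and the noise terms, all
  -- expressed through the uncontrolled process `ξ`.
  refine ⟨ip x₀ (act (S 0) x₀) + ∑ t ∈ Finset.range N,
    (ip (act (L t) (e t)) (act (G t) (act (L t) (e t))) +
      (2 * ip (w t) (act (S (t + 1)) (act A (ξ t))) + ip (w t) (act (S (t + 1)) (w t)))), ?_⟩
  intro x u h0 hx hu
  have hmem : ∀ t ≤ N, ∀ i, x t i - ξ t i ∈ H t := fun t ht i =>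
    sub_freeEvolution_mem hH h0 hx hu ht i
  have step : ∀ t < N, ip (x t) (act Q (x t)) + ip (u t) (act R (u t)) =
      ip (x t) (act (S t) (x t)) - ip (x (t + 1)) (act (S (t + 1)) (x (t + 1))) +
      (ip (act (L t) (e t)) (act (G t) (act (L t) (e t))) +
      (2 * ip (w t) (act (S (t + 1)) (act A (ξ t))) + ip (w t) (act (S (t + 1)) (w t)))) +
      ip (u t + act (L t) fun i => (H t).starProjection (x t i))
        (act (G t) (u t + act (L t) fun i => (H t).starProjection (x t i))) := by
    intro t ht
    have hSt : S t = riccati (S (t + 1)) A B Q R := by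
      simp only [hSdef]
      rw [show N - t = (N - (t + 1)) + 1 by omega]; rfl
    have hc := completion_step (hSpos (t + 1)) A B Q hR (x t) (w t) (u t)
    rw [← hx t ht, ← hSt] at hc
    set r : U → E := u t + act (L t) fun i => (H t).starProjection (x t i) with hr
    -- The projection fixes $x-\xi\in H_t$, so $x$ and $\xi$ have the same error `e`.
    have hxe : ∀ i, x t i = (H t).starProjection (x t i) + e t i := by
      intro i
      have h1 := Submodule.starProjection_eq_self_iff.2 (hmem t ht.le i)
      rw [map_sub] at h1
      simp only [hedef]
      have : (H t).starProjection (x t i) = x t i - ξ t i + (H t).starProjection (ξ t i) := by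
        rw [← h1]; abel
      rw [this]; abel
    have hres : u t + act (gain (S (t + 1)) A B R) (x t) = r + act (L t) (e t) := by
      rw [hr, add_assoc, ← act_add]
      congr 2
      funext i; exact hxe i
    have hrm : ∀ i, r i ∈ H t := fun i => add_mem (hu t ht i)
      (act_mem _ (fun j => Submodule.starProjection_apply_mem _ _) i)
    have hem : ∀ i, e t i ∈ (H t)ᗮ := fun i => Submodule.sub_starProjection_mem_orthogonal _
    have hGt : (G t)ᵀ = G t :=
      transpose_eq_of_posSemidef (posDef_innovation (hSpos (t + 1)) B hR).posSemidef
    have hcross : ip r (act (G t) (act (L t) (e t))) = 0 :=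
      ip_eq_zero_of_orthogonal hrm (act_mem _ (act_mem _ hem))
    -- The controlled part of the prediction lies in $H_t$ and is orthogonal to the noise; only the
    -- uncontrolled part contributes.
    have hw' : ip (w t) (act (S (t + 1)) (act A (x t) + act B (u t))) =
        ip (w t) (act (S (t + 1)) (act A (ξ t))) := by
      have h1 : ip (w t) (act (S (t + 1)) (act A (x t - ξ t) + act B (u t))) = 0 := by
        rw [ip_comm]
        refine ip_eq_zero_of_orthogonal (act_mem _ fun j => ?_) (hw t ht)
        exact add_mem (act_mem A (hmem t ht.le) j) (act_mem B (hu t ht) j)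
      have h2 : act A (x t) + act B (u t) = act A (ξ t) + (act A (x t - ξ t) + act B (u t)) := by
        rw [act_sub]; abel
      rw [h2, act_add (S (t + 1)), ip_add_right, h1, add_zero]
    rw [hw', hres] at hc
    change _ = _ + ip (r + act (L t) (e t)) (act (G t) (r + act (L t) (e t))) + _ at hc
    have hq : ip (r + act (L t) (e t)) (act (G t) (r + act (L t) (e t))) =
        ip r (act (G t) r) + ip (act (L t) (e t)) (act (G t) (act (L t) (e t))) := by
      simp only [act_add, ip_add_left, ip_add_right]
      rw [ip_act_symm hGt (act (L t) (e t)) r, hcross]; ring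
    rw [hq] at hc
    linarith
  have htel : ∀ k ≤ N, ∑ t ∈ Finset.range k,
      (ip (x t) (act (S t) (x t)) - ip (x (t + 1)) (act (S (t + 1)) (x (t + 1)))) =
      ip (x 0) (act (S 0) (x 0)) - ip (x k) (act (S k) (x k)) := fun k _ =>
    Finset.sum_range_sub' (fun t => ip (x t) (act (S t) (x t))) k
  have hSN : S N = QT := by simp [hSdef, riccatiSol]
  rw [quadCost, Finset.sum_congr rfl fun t ht => step t (Finset.mem_range.1 ht),
    Finset.sum_add_distrib, Finset.sum_add_distrib, htel N le_rfl, hSN, h0]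
  ring

end Completion

end MajorMinor

namespace MajorMinor

variable {n : ℕ} {Ω : Type*}

/-! ### Spans of families of real functions -/

section FunSpan

variable {ι κ : Type*}

/-- The span of the coordinates of a vector valued function. -/
def funSpan (f : Ω → ι → ℝ) : Submodule ℝ (Ω → ℝ) :=
  Submodule.span ℝ (Set.range fun k ω => f ω k)

/-- Adjoin the constant coordinate `1`. -/
def withOne (f : Ω → ι → ℝ) : Ω → Option ι → ℝ := fun ω k => k.elim 1 (f ω)

theorem coord_mem_funSpan (f : Ω → ι → ℝ) (k : ι) : (fun ω => f ω k) ∈ funSpan f :=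
  Submodule.subset_span ⟨k, rfl⟩

theorem one_mem_funSpan_withOne (f : Ω → ι → ℝ) : (fun _ => 1) ∈ funSpan (withOne f) :=
  coord_mem_funSpan (withOne f) none

theorem funSpan_le_iff {f : Ω → ι → ℝ} {V : Submodule ℝ (Ω → ℝ)} :
    funSpan f ≤ V ↔ ∀ k, (fun ω => f ω k) ∈ V := by
  rw [funSpan, Submodule.span_le]
  exact ⟨fun h k => h ⟨k, rfl⟩, fun h => by rintro _ ⟨k, rfl⟩; exact h k⟩

theorem funSpan_le_withOne (f : Ω → ι → ℝ) : funSpan f ≤ funSpan (withOne f) :=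
  funSpan_le_iff.2 fun k => coord_mem_funSpan (withOne f) (some k)

theorem withOne_le_iff {f : Ω → ι → ℝ} {V : Submodule ℝ (Ω → ℝ)} :
    funSpan (withOne f) ≤ V ↔ (fun _ => 1) ∈ V ∧ funSpan f ≤ V := by
  rw [funSpan_le_iff, Option.forall, funSpan_le_iff]; rfl

theorem exists_affineMap_of_mem_funSpan [Fintype ι] {f : Ω → ι → ℝ} {g : Ω → ℝ}
    (hg : g ∈ funSpan (withOne f)) : ∃ φ : (ι → ℝ) →ᵃ[ℝ] ℝ, ∀ ω, g ω = φ (f ω) := by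
  obtain ⟨c, rfl⟩ := (Submodule.mem_span_range_iff_exists_fun ℝ).1 hg
  refine ⟨(∑ k, c (some k) • (LinearMap.proj k : (ι → ℝ) →ₗ[ℝ] ℝ)).toAffineMap +
    AffineMap.const ℝ _ (c none), fun ω => ?_⟩
  simp [withOne, Fintype.sum_option, add_comm]

theorem affineMap_comp_mem [Fintype ι] [DecidableEq ι] {V : Submodule ℝ (Ω → ℝ)}
    (h1 : (fun _ => 1) ∈ V)
    {f : Ω → ι → ℝ} (hf : ∀ k, (fun ω => f ω k) ∈ V) (φ : (ι → ℝ) →ᵃ[ℝ] (κ → ℝ)) (a : κ) :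
    (fun ω => φ (f ω) a) ∈ V := by
  have h : (fun ω => φ (f ω) a) =
      φ 0 a • (fun _ => (1 : ℝ)) + ∑ k, φ.linear (Pi.single k 1) a • fun ω => f ω k := by
    funext ω
    have h2 : φ (f ω) = φ.linear (f ω) + φ 0 := by
      have := φ.linearMap_vsub (f ω) 0
      simp only [vsub_eq_sub, sub_zero] at this
      rw [this]; abel
    have h3 : φ.linear (f ω) = ∑ k, f ω k • φ.linear (Pi.single k 1) := by
      conv_lhs => rw [pi_eq_sum_univ' (f ω)]
      rw [map_sum]
      refine Finset.sum_congr rfl fun k _ => ?_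
      rw [map_smul]
    rw [h2, h3]
    simp [Finset.sum_apply, mul_comm, add_comm]
  rw [h]
  exact add_mem (V.smul_mem _ h1) (V.sum_mem fun k _ => V.smul_mem _ (hf k))

/-- Linear relations survive substitution. With `θ ω = (u, ω)`, a relation valid for all controls is
specialized to one closed loop. -/
theorem comp_mem_funSpan {Ω' : Type*} {f : Ω → ι → ℝ} {g : Ω → ℝ} (hg : g ∈ funSpan f)
    (θ : Ω' → Ω) : (fun ω => g (θ ω)) ∈ funSpan fun ω => f (θ ω) := by
  have : funSpan f ≤ (funSpan fun ω => f (θ ω)).comap (LinearMap.funLeft ℝ ℝ θ) :=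
    funSpan_le_iff.2 fun k => coord_mem_funSpan (fun ω => f (θ ω)) k
  exact this hg

end FunSpan

/-! ### Block rows of matrices with the major-minor sparsity pattern -/

section Sparse

variable {V : Type*} [AddCommGroup V] [Module ℝ V] {d e : Fin (n + 1) → ℕ}

theorem act_sparse_zero {A : Matrix (Stacked d) (Stacked e) ℝ}
    (hA : ∀ i j : Fin (n + 1), i ≠ j → j ≠ 0 → ∀ a b, A ⟨i, a⟩ ⟨j, b⟩ = 0)
    (x : Stacked e → V) (a : Fin (d 0)) :
    act A x ⟨0, a⟩ = ∑ b, A ⟨0, a⟩ ⟨0, b⟩ • x ⟨0, b⟩ := by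
  rw [act, Fintype.sum_sigma, Fin.sum_univ_succ]
  simp [hA 0 _ (Fin.succ_ne_zero _).symm (Fin.succ_ne_zero _)]

theorem act_sparse_succ {A : Matrix (Stacked d) (Stacked e) ℝ}
    (hA : ∀ i j : Fin (n + 1), i ≠ j → j ≠ 0 → ∀ a b, A ⟨i, a⟩ ⟨j, b⟩ = 0)
    (x : Stacked e → V) (i : Fin n) (a : Fin (d i.succ)) :
    act A x ⟨i.succ, a⟩ = ∑ b, A ⟨i.succ, a⟩ ⟨0, b⟩ • x ⟨0, b⟩ +
      act (diagBlock A i.succ) (fun b => x ⟨i.succ, b⟩) a := by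
  rw [act, Fintype.sum_sigma, Fin.sum_univ_succ, Finset.sum_eq_single i]
  · rfl
  · intro j _ hj
    refine Finset.sum_eq_zero fun b _ => ?_
    rw [hA _ _ (fun h => hj (Fin.succ_injective _ h).symm) (Fin.succ_ne_zero _), zero_smul]
  · simp

theorem act_sparse_zero_mem {A : Matrix (Stacked d) (Stacked e) ℝ}
    (hA : ∀ i j : Fin (n + 1), i ≠ j → j ≠ 0 → ∀ a b, A ⟨i, a⟩ ⟨j, b⟩ = 0)
    {x : Stacked e → V} {K : Submodule ℝ V} (hx : ∀ b, x ⟨0, b⟩ ∈ K) (a : Fin (d 0)) :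
    act A x ⟨0, a⟩ ∈ K := by
  rw [act_sparse_zero hA]
  exact K.sum_mem fun b _ => K.smul_mem _ (hx b)

theorem act_sparse_succ_mem {A : Matrix (Stacked d) (Stacked e) ℝ}
    (hA : ∀ i j : Fin (n + 1), i ≠ j → j ≠ 0 → ∀ a b, A ⟨i, a⟩ ⟨j, b⟩ = 0)
    {x : Stacked e → V} {K : Submodule ℝ V} (i : Fin n) (hx : ∀ b, x ⟨0, b⟩ ∈ K)
    (hi : ∀ b, x ⟨i.succ, b⟩ ∈ K) (a : Fin (d i.succ)) :
    act A x ⟨i.succ, a⟩ ∈ K := by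
  rw [act_sparse_succ hA]
  exact add_mem (K.sum_mem fun b _ => K.smul_mem _ (hx b)) (act_mem _ hi a)

theorem coord_mulVec {a b : Type*} [Fintype b] (A : Matrix a b ℝ) (x : Ω → b → ℝ) (p : a) :
    (fun ω => (A *ᵥ x ω) p) = act A (fun q ω => x ω q) p := by
  funext ω; simp [act, Matrix.mulVec, dotProduct]

end Sparse

/-! ### Control-free reduction of the information -/

section Reduction

variable {M : Model n} (P : Noise M Ω)

/-- Primitive random variables of the major agent that have entered the state by time `t`. -/
def majorPrim (t : ℕ) (ω : Ω) : Fin (M.dx 0) ⊕ (Fin t × Fin (M.dx 0)) → ℝ :=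
  Sum.elim (P.init 0 ω) fun p => P.w 0 p.1 ω p.2

/-- State of a minor agent driven by its own primitive random variables only. -/
def freeState (i : Fin n) : ℕ → Ω → Fin (M.dx i.succ) → ℝ
  | 0, ω => P.init i.succ ω
  | t + 1, ω => diagBlock M.A i.succ *ᵥ freeState i t ω + P.w i.succ t ω

/-- Output of a minor agent driven by its own primitive random variables only. -/
def freeOutput (i : Fin n) (t : ℕ) (ω : Ω) : Fin (M.dy i) → ℝ :=
  M.C i *ᵥ freeState P i t ω + P.v i t ω

/-- The control-free outputs of a minor agent before time `t`. -/
def minorPrim (i : Fin n) (t : ℕ) (ω : Ω) : Fin t × Fin (M.dy i) → ℝ := fun p =>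
  freeOutput P i p.1 ω p.2

/-- Affine functions of the primitive random variables of the major agent before time `t`. -/
def majorSpan (t : ℕ) : Submodule ℝ (Ω → ℝ) := funSpan (withOne (majorPrim P t))

/-- Affine functions of the primitive random variables of the major agent before time `t` and
of the control-free outputs of a minor agent before time `s`. -/
def minorSpan (i : Fin n) (t s : ℕ) : Submodule ℝ (Ω → ℝ) :=
  majorSpan P t ⊔ funSpan (minorPrim P i s)

theorem init_mem_majorPrim (t : ℕ) (a : Fin (M.dx 0)) :
    (fun ω => P.init 0 ω a) ∈ funSpan (majorPrim P t) :=
  coord_mem_funSpan (majorPrim P t) (Sum.inl a)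

theorem w_mem_majorPrim {s t : ℕ} (h : s < t) (a : Fin (M.dx 0)) :
    (fun ω => P.w 0 s ω a) ∈ funSpan (majorPrim P t) :=
  coord_mem_funSpan (majorPrim P t) (Sum.inr (⟨s, h⟩, a))

theorem freeOutput_mem_minorPrim (i : Fin n) {s t : ℕ} (h : s < t) (b : Fin (M.dy i)) :
    (fun ω => freeOutput P i s ω b) ∈ funSpan (minorPrim P i t) :=
  coord_mem_funSpan (minorPrim P i t) (⟨s, h⟩, b)

theorem majorPrim_mono : Monotone fun t => funSpan (majorPrim P t) := fun s t h => by
  refine funSpan_le_iff.2 ?_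
  rintro (a | ⟨r, a⟩)
  · exact init_mem_majorPrim P t a
  · exact w_mem_majorPrim P (r.2.trans_le h) a

theorem minorPrim_mono (i : Fin n) : Monotone fun t => funSpan (minorPrim P i t) := fun s t h => by
  refine funSpan_le_iff.2 ?_
  rintro ⟨r, a⟩
  exact freeOutput_mem_minorPrim P i (r.2.trans_le h) a

theorem majorSpan_mono : Monotone (majorSpan P) := fun _ _ h =>
  withOne_le_iff.2 ⟨one_mem_funSpan_withOne _,
    (majorPrim_mono P h).trans (funSpan_le_withOne _)⟩

theorem minorSpan_mono (i : Fin n) {t t' s s' : ℕ} (h : t ≤ t') (h' : s ≤ s') :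
    minorSpan P i t s ≤ minorSpan P i t' s' :=
  sup_le_sup (majorSpan_mono P h) (minorPrim_mono P i h')

theorem coord_state_succ (u : Control M Ω) (t : ℕ) (p : Stacked M.dx) :
    (fun ω => state P u (t + 1) ω p) = act M.A (fun q ω => state P u t ω q) p +
      act M.B (fun q ω => u t ω q) p + fun ω => P.W t ω p := by
  rw [← coord_mulVec, ← coord_mulVec]; rfl

theorem coord_freeState_succ (i : Fin n) (t : ℕ) (a : Fin (M.dx i.succ)) :
    (fun ω => freeState P i (t + 1) ω a) =
      act (diagBlock M.A i.succ) (fun b ω => freeState P i t ω b) a +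
        fun ω => P.w i.succ t ω a := by
  rw [← coord_mulVec]; rfl

theorem coord_freeOutput (i : Fin n) (t : ℕ) (b : Fin (M.dy i)) :
    (fun ω => freeOutput P i t ω b) =
      act (M.C i) (fun a ω => freeState P i t ω a) b + fun ω => P.v i t ω b := by
  rw [← coord_mulVec]; rfl

theorem coord_output (u : Control M Ω) (i : Fin n) (t : ℕ) (b : Fin (M.dy i)) :
    (fun ω => output P u i t ω b) =
      act (M.C i) (fun a ω => state P u t ω ⟨i.succ, a⟩) b + fun ω => P.v i t ω b := by
  rw [← coord_mulVec]; rfl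

/-- The part of a minor agent's state that is not driven by its own primitive random variables. -/
theorem coord_state_sub_freeState_succ (u : Control M Ω) (i : Fin n) (t : ℕ)
    (a : Fin (M.dx i.succ)) :
    (fun ω => state P u (t + 1) ω ⟨i.succ, a⟩ - freeState P i (t + 1) ω a) =
      (∑ b, M.A ⟨i.succ, a⟩ ⟨0, b⟩ • fun ω => state P u t ω ⟨0, b⟩) +
        act (diagBlock M.A i.succ)
          (fun b ω => state P u t ω ⟨i.succ, b⟩ - freeState P i t ω b) a +
        act M.B (fun q ω => u t ω q) ⟨i.succ, a⟩ := by
  have h1 := coord_state_succ P u t ⟨i.succ, a⟩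
  have h2 := coord_freeState_succ P i t a
  rw [act_sparse_succ M.A_sparse] at h1
  have h3 : act (diagBlock M.A i.succ)
      (fun b ω => state P u t ω ⟨i.succ, b⟩ - freeState P i t ω b) a =
      act (diagBlock M.A i.succ) (fun b ω => state P u t ω ⟨i.succ, b⟩) a -
        act (diagBlock M.A i.succ) (fun b ω => freeState P i t ω b) a := by
    rw [← Pi.sub_apply, ← act_sub]; rfl
  rw [h3]
  change (fun ω => state P u (t + 1) ω ⟨i.succ, a⟩) - (fun ω => freeState P i (t + 1) ω a) = _
  rw [h1, h2]
  have h4 : (fun ω => P.W t ω ⟨i.succ, a⟩) = fun ω => P.w i.succ t ω a := rfl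
  rw [h4]; abel

/-- The observation noise is the same in both outputs and cancels. -/
theorem coord_output_sub_freeOutput (u : Control M Ω) (i : Fin n) (t : ℕ) (b : Fin (M.dy i)) :
    (fun ω => output P u i t ω b - freeOutput P i t ω b) =
      act (M.C i) (fun a ω => state P u t ω ⟨i.succ, a⟩ - freeState P i t ω a) b := by
  have h3 : act (M.C i) (fun a ω => state P u t ω ⟨i.succ, a⟩ - freeState P i t ω a) b =
      act (M.C i) (fun a ω => state P u t ω ⟨i.succ, a⟩) b -
        act (M.C i) (fun a ω => freeState P i t ω a) b := by
    rw [← Pi.sub_apply, ← act_sub]; rfl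
  rw [h3]
  change (fun ω => output P u i t ω b) - (fun ω => freeOutput P i t ω b) = _
  rw [coord_output, coord_freeOutput]; abel

/-! ### Closed-loop signals as functions of control-free variables -/

section ClosedLoop

variable (g : AffineStrategy M)

theorem control_zero (t : ℕ) (a : Fin (M.du 0)) :
    (fun ω => g.control P t ω ⟨0, a⟩) =
      fun ω => g.major t (majorInfo P (g.control P) t ω) a := by
  conv_lhs => rw [g.control_eq P t]
  rfl

theorem control_succ (i : Fin n) (t : ℕ) (a : Fin (M.du i.succ)) :
    (fun ω => g.control P t ω ⟨i.succ, a⟩) =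
      fun ω => g.minor i t (minorInfo P (g.control P) i t ω) a := by
  conv_lhs => rw [g.control_eq P t]
  rfl

/-- The block row of the major agent involves only its own state and control. The induction is
strong because the control law uses the whole history. -/
theorem major_mem_majorSpan (t : ℕ) :
    (∀ a, (fun ω => state P (g.control P) t ω ⟨0, a⟩) ∈ majorSpan P t) ∧
      ∀ a, (fun ω => g.control P t ω ⟨0, a⟩) ∈ majorSpan P t := by
  induction t using Nat.strong_induction_on with
  | _ t ih =>
    have hs : ∀ a, (fun ω => state P (g.control P) t ω ⟨0, a⟩) ∈ majorSpan P t := by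
      intro a
      cases t with
      | zero => exact funSpan_le_withOne _ (init_mem_majorPrim P 0 a)
      | succ t =>
        have h := ih t t.lt_succ_self
        rw [coord_state_succ]
        exact add_mem (add_mem
          (act_sparse_zero_mem M.A_sparse (fun b => majorSpan_mono P t.le_succ (h.1 b)) a)
          (act_sparse_zero_mem M.B_sparse (fun b => majorSpan_mono P t.le_succ (h.2 b)) a))
          (funSpan_le_withOne _ (w_mem_majorPrim P t.lt_succ_self a))
    refine ⟨hs, fun a => ?_⟩
    rw [control_zero]
    refine affineMap_comp_mem (one_mem_funSpan_withOne _) ?_ _ _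
    rintro (⟨s, b⟩ | ⟨s, b⟩)
    · rcases (Nat.lt_succ_iff.1 s.2).lt_or_eq with hlt | heq
      · exact majorSpan_mono P hlt.le ((ih s hlt).1 b)
      · simp only [majorInfo, Sum.elim_inl, heq]
        exact hs b
    · exact majorSpan_mono P s.2.le ((ih s s.2).2 b)

theorem majorInfo_mem_majorSpan (t : ℕ) (k : M.MajorIdx t) :
    (fun ω => majorInfo P (g.control P) t ω k) ∈ majorSpan P t := by
  rcases k with ⟨s, b⟩ | ⟨s, b⟩
  · exact majorSpan_mono P (Nat.lt_succ_iff.1 s.2) ((major_mem_majorSpan P g s).1 b)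
  · exact majorSpan_mono P s.2.le ((major_mem_majorSpan P g s).2 b)

/-- The indices record the timing: the deviation of the state at $t$ depends on outputs before $t$,
whereas the information and the control at $t$ also use the output at $t$, hence `t + 1`. -/
theorem minor_mem_minorSpan (i : Fin n) (t : ℕ) :
    (∀ a, (fun ω => state P (g.control P) t ω ⟨i.succ, a⟩ - freeState P i t ω a) ∈
        minorSpan P i t t) ∧
      (∀ k, (fun ω => minorInfo P (g.control P) i t ω k) ∈ minorSpan P i t (t + 1)) ∧
      ∀ a, (fun ω => g.control P t ω ⟨i.succ, a⟩) ∈ minorSpan P i t (t + 1) := by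
  induction t using Nat.strong_induction_on with
  | _ t ih =>
    have hs : ∀ a, (fun ω => state P (g.control P) t ω ⟨i.succ, a⟩ - freeState P i t ω a) ∈
        minorSpan P i t t := by
      intro a
      cases t with
      | zero =>
        simp only [state, freeState, Noise.x₁, sub_self]
        exact zero_mem _
      | succ t =>
        have h := ih t t.lt_succ_self
        have hm := major_mem_majorSpan P g t
        have hle : majorSpan P t ≤ minorSpan P i (t + 1) (t + 1) :=
          (majorSpan_mono P t.le_succ).trans le_sup_left
        rw [coord_state_sub_freeState_succ]
        refine add_mem (add_mem (sum_mem fun b _ => Submodule.smul_mem _ _ (hle (hm.1 b)))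
          (act_mem _ (fun b => minorSpan_mono P i t.le_succ t.le_succ (h.1 b)) a))
          (act_sparse_succ_mem M.B_sparse i (fun b => hle (hm.2 b))
            (fun b => minorSpan_mono P i t.le_succ le_rfl (h.2.2 b)) a)
    have hout : ∀ s ≤ t, ∀ b, (fun ω => output P (g.control P) i s ω b) ∈
        minorSpan P i t (t + 1) := by
      intro s hst b
      have h1 : ∀ a, (fun ω => state P (g.control P) s ω ⟨i.succ, a⟩ - freeState P i s ω a) ∈
          minorSpan P i t (t + 1) := by
        intro a
        rcases hst.lt_or_eq with hlt | rfl
        · exact minorSpan_mono P i hst (by omega) ((ih s hlt).1 a)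
        · exact minorSpan_mono P i le_rfl (by omega) (hs a)
      have h2 := add_mem (act_mem (M.C i) h1 b)
        (le_sup_right (a := majorSpan P t)
          (freeOutput_mem_minorPrim P i (show s < t + 1 by omega) b))
      rw [← coord_output_sub_freeOutput] at h2
      convert h2 using 1
      funext ω; simp
    have hinfo : ∀ k, (fun ω => minorInfo P (g.control P) i t ω k) ∈
        minorSpan P i t (t + 1) := by
      rintro (k | ⟨s, b⟩ | ⟨s, b⟩)
      · exact le_sup_left (a := majorSpan P t) (majorInfo_mem_majorSpan P g t k)
      · exact hout s (Nat.lt_succ_iff.1 s.2) b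
      · exact minorSpan_mono P i s.2.le (by have := s.2; omega) ((ih s s.2).2.2 b)
    refine ⟨hs, hinfo, fun a => ?_⟩
    rw [control_succ]
    exact affineMap_comp_mem (le_sup_left (a := majorSpan P t) (one_mem_funSpan_withOne _))
      hinfo _ _

end ClosedLoop

/-! Conversely, the control-free variables are linear functions of the information, the same for
all control processes. -/

section Realization

/-- Spans are taken among functions of the pair (control, sample point). Membership thus provides
coefficients that serve all control processes at once. -/
theorem state_mem_majorInfo {s t : ℕ} (h : s ≤ t) (a : Fin (M.dx 0)) :
    (fun q : Control M Ω × Ω => state P q.1 s q.2 ⟨0, a⟩) ∈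
      funSpan fun q : Control M Ω × Ω => majorInfo P q.1 t q.2 :=
  coord_mem_funSpan (fun q : Control M Ω × Ω => majorInfo P q.1 t q.2)
    (Sum.inl (⟨s, Nat.lt_succ_of_le h⟩, a))

theorem control_mem_majorInfo {s t : ℕ} (h : s < t) (a : Fin (M.du 0)) :
    (fun q : Control M Ω × Ω => q.1 s q.2 ⟨0, a⟩) ∈
      funSpan fun q : Control M Ω × Ω => majorInfo P q.1 t q.2 :=
  coord_mem_funSpan (fun q : Control M Ω × Ω => majorInfo P q.1 t q.2)
    (Sum.inr (⟨s, h⟩, a))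

/-- The dynamics are solved for the noise: $w_0(s)=x_0(s+1)-A_{00}x_0(s)-B_{00}u_0(s)$, where
$s+1\le t$. -/
theorem majorPrim_mem_majorInfo (t : ℕ) {f : Ω → ℝ} (hf : f ∈ funSpan (majorPrim P t)) :
    (fun q : Control M Ω × Ω => f q.2) ∈
      funSpan fun q : Control M Ω × Ω => majorInfo P q.1 t q.2 := by
  have key : funSpan (majorPrim P t) ≤
      (funSpan fun q : Control M Ω × Ω => majorInfo P q.1 t q.2).comap
        (LinearMap.funLeft ℝ ℝ Prod.snd) := by
    refine funSpan_le_iff.2 ?_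
    rintro (a | ⟨s, a⟩)
    · exact state_mem_majorInfo P (Nat.zero_le t) a
    · have h : (fun q : Control M Ω × Ω => P.w 0 s q.2 a) =
          (fun q : Control M Ω × Ω => state P q.1 (s + 1) q.2 ⟨0, a⟩) -
            act M.A (fun p (q : Control M Ω × Ω) => state P q.1 s q.2 p) ⟨0, a⟩ -
            act M.B (fun p (q : Control M Ω × Ω) => q.1 s q.2 p) ⟨0, a⟩ := by
        rw [← coord_mulVec M.A (fun q : Control M Ω × Ω => state P q.1 s q.2),
          ← coord_mulVec M.B (fun q : Control M Ω × Ω => q.1 s q.2)]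
        funext q
        simp only [state, Noise.W, Pi.add_apply, Pi.sub_apply]
        ring
      rw [Submodule.mem_comap]
      change (fun q : Control M Ω × Ω => P.w 0 s q.2 a) ∈
        (funSpan fun q : Control M Ω × Ω => majorInfo P q.1 t q.2)
      rw [h]
      exact sub_mem (sub_mem (state_mem_majorInfo P s.2 a)
        (act_sparse_zero_mem M.A_sparse (fun b => state_mem_majorInfo P s.2.le b) a))
        (act_sparse_zero_mem M.B_sparse (fun b => control_mem_majorInfo P s.2 b) a)
  exact key hf

theorem majorInfo_le_minorInfo (i : Fin n) (t : ℕ) :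
    (funSpan fun q : Control M Ω × Ω => majorInfo P q.1 t q.2) ≤
      funSpan fun q : Control M Ω × Ω => minorInfo P q.1 i t q.2 :=
  funSpan_le_iff.2 fun k =>
    coord_mem_funSpan (fun q : Control M Ω × Ω => minorInfo P q.1 i t q.2) (Sum.inl k)

/-- The deviation obeys a noiseless recursion driven by $x_0$, $u_0$ and $u_i$, all of which agent
$i$ knows. -/
theorem state_sub_freeState_mem_minorInfo (i : Fin n) {s t : ℕ} (h : s ≤ t)
    (a : Fin (M.dx i.succ)) :
    (fun q : Control M Ω × Ω => state P q.1 s q.2 ⟨i.succ, a⟩ - freeState P i s q.2 a) ∈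
      funSpan fun q : Control M Ω × Ω => minorInfo P q.1 i t q.2 := by
  induction s generalizing a with
  | zero => simp only [state, freeState, Noise.x₁, sub_self]; exact zero_mem _
  | succ s ih =>
    have e : (fun q : Control M Ω × Ω =>
        state P q.1 (s + 1) q.2 ⟨i.succ, a⟩ - freeState P i (s + 1) q.2 a) =
      (∑ b, M.A ⟨i.succ, a⟩ ⟨0, b⟩ • fun q : Control M Ω × Ω => state P q.1 s q.2 ⟨0, b⟩) +
        act (diagBlock M.A i.succ) (fun b (q : Control M Ω × Ω) =>
          state P q.1 s q.2 ⟨i.succ, b⟩ - freeState P i s q.2 b) a +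
        act M.B (fun p (q : Control M Ω × Ω) => q.1 s q.2 p) ⟨i.succ, a⟩ := by
      funext ⟨u, ω⟩
      have := congrFun (coord_state_sub_freeState_succ P u i s a) ω
      simpa [act, Finset.sum_apply] using this
    rw [e]
    have hle := majorInfo_le_minorInfo P i t
    refine add_mem (add_mem (sum_mem fun b _ => Submodule.smul_mem _ _
      (hle (state_mem_majorInfo P (by omega) b))) (act_mem _ (fun b => ih (by omega) b) a)) ?_
    refine act_sparse_succ_mem M.B_sparse i
      (fun b => hle (control_mem_majorInfo P (by omega) b)) (fun b => ?_) a
    exact coord_mem_funSpan (fun q : Control M Ω × Ω => minorInfo P q.1 i t q.2)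
      (Sum.inr (Sum.inr (⟨s, h⟩, b)))

theorem minorPrim_mem_minorInfo (i : Fin n) (t : ℕ) {f : Ω → ℝ}
    (hf : f ∈ funSpan (minorPrim P i (t + 1))) :
    (fun q : Control M Ω × Ω => f q.2) ∈
      funSpan fun q : Control M Ω × Ω => minorInfo P q.1 i t q.2 := by
  have key : funSpan (minorPrim P i (t + 1)) ≤
      (funSpan fun q : Control M Ω × Ω => minorInfo P q.1 i t q.2).comap
        (LinearMap.funLeft ℝ ℝ Prod.snd) := by
    refine funSpan_le_iff.2 ?_
    rintro ⟨s, b⟩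
    have h : (fun q : Control M Ω × Ω => freeOutput P i s q.2 b) =
        (fun q : Control M Ω × Ω => output P q.1 i s q.2 b) -
          act (M.C i) (fun a (q : Control M Ω × Ω) =>
            state P q.1 s q.2 ⟨i.succ, a⟩ - freeState P i s q.2 a) b := by
      funext ⟨u, ω⟩
      have := congrFun (coord_output_sub_freeOutput P u i s b) ω
      simp only [act, Finset.sum_apply, Pi.smul_apply, Pi.sub_apply] at this ⊢
      rw [← this]; ring
    rw [Submodule.mem_comap]
    change (fun q : Control M Ω × Ω => freeOutput P i s q.2 b) ∈
      (funSpan fun q : Control M Ω × Ω => minorInfo P q.1 i t q.2)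
    rw [h]
    refine sub_mem ?_ (act_mem _ (fun a =>
      state_sub_freeState_mem_minorInfo P i (Nat.lt_succ_iff.1 s.2) a) b)
    exact coord_mem_funSpan (fun q : Control M Ω × Ω => minorInfo P q.1 i t q.2)
      (Sum.inr (Sum.inl (s, b)))
  exact key hf

theorem majorSpan_realizable {t : ℕ} {f : Ω → ℝ} (hf : f ∈ majorSpan P t) :
    ∃ φ : (M.MajorIdx t → ℝ) →ᵃ[ℝ] ℝ, ∀ (u : Control M Ω) (ω : Ω),
      f ω = φ (majorInfo P u t ω) := by
  have key : majorSpan P t ≤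
      (funSpan (withOne fun q : Control M Ω × Ω => majorInfo P q.1 t q.2)).comap
        (LinearMap.funLeft ℝ ℝ Prod.snd) :=
    withOne_le_iff.2 ⟨one_mem_funSpan_withOne _, fun f hf =>
      funSpan_le_withOne _ (majorPrim_mem_majorInfo P t hf)⟩
  obtain ⟨φ, hφ⟩ := exists_affineMap_of_mem_funSpan (key hf)
  exact ⟨φ, fun u ω => hφ (u, ω)⟩

theorem minorSpan_realizable {i : Fin n} {t : ℕ} {f : Ω → ℝ}
    (hf : f ∈ minorSpan P i t (t + 1)) :
    ∃ φ : (M.MinorIdx i t → ℝ) →ᵃ[ℝ] ℝ, ∀ (u : Control M Ω) (ω : Ω),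
      f ω = φ (minorInfo P u i t ω) := by
  have key : minorSpan P i t (t + 1) ≤
      (funSpan (withOne fun q : Control M Ω × Ω => minorInfo P q.1 i t q.2)).comap
        (LinearMap.funLeft ℝ ℝ Prod.snd) := by
    refine sup_le (withOne_le_iff.2 ⟨one_mem_funSpan_withOne _, fun f hf => ?_⟩) fun f hf => ?_
    · exact funSpan_le_withOne _
        (majorInfo_le_minorInfo P i t (majorPrim_mem_majorInfo P t hf))
    · exact funSpan_le_withOne _ (minorPrim_mem_minorInfo P i t hf)
  obtain ⟨φ, hφ⟩ := exists_affineMap_of_mem_funSpan (key hf)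
  exact ⟨φ, fun u ω => hφ (u, ω)⟩

/-- Every control process with the right measurability structure is generated by an affine
strategy. -/
theorem exists_strategy (u : Control M Ω)
    (h0 : ∀ t a, (fun ω => u t ω ⟨0, a⟩) ∈ majorSpan P t)
    (hi : ∀ i t a, (fun ω => u t ω ⟨Fin.succ i, a⟩) ∈ minorSpan P i t (t + 1)) :
    ∃ g : AffineStrategy M, g.control P = u := by
  choose φ hφ using fun t a => majorSpan_realizable P (h0 t a)
  choose ψ hψ using fun i t a => minorSpan_realizable P (hi i t a)
  refine ⟨⟨fun t => AffineMap.pi (φ t), fun i t => AffineMap.pi (ψ i t)⟩, ?_⟩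
  -- The affine identities hold for every control process, in particular for the closed loop that
  -- the laws themselves generate, so no induction over time is needed.
  funext t ω ⟨j, a⟩
  induction j using Fin.cases with
  | zero => rw [AffineStrategy.control_eq]; exact (hφ t a _ ω).symm
  | succ i => rw [AffineStrategy.control_eq]; exact (hψ i t a _ ω).symm

end Realization

end Reduction

end MajorMinor

namespace MajorMinor

variable {n : ℕ} {Ω : Type*} [MeasurableSpace Ω]

/-! ### Square integrable functions and their classes -/

section Classes

variable (μ : Measure Ω) {ι κ : Type*}

/-- The space of square integrable functions. -/
def memLpTwo : Submodule ℝ (Ω → ℝ) where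
  carrier := {f | MemLp f 2 μ}
  add_mem' hf hg := MemLp.add hf hg
  zero_mem' := MemLp.zero
  smul_mem' c _ hf := MemLp.const_smul hf c

variable {μ}

theorem toL2_eq_toLp {f : Ω → ℝ} (hf : f ∈ memLpTwo μ) : toL2 μ f = MemLp.toLp f hf :=
  dif_pos hf

theorem coeFn_toL2 {f : Ω → ℝ} (hf : f ∈ memLpTwo μ) : toL2 μ f =ᵐ[μ] f := by
  rw [toL2_eq_toLp hf]; exact MemLp.coeFn_toLp _

theorem toL2_add {f g : Ω → ℝ} (hf : f ∈ memLpTwo μ) (hg : g ∈ memLpTwo μ) :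
    toL2 μ (f + g) = toL2 μ f + toL2 μ g := by
  rw [toL2_eq_toLp hf, toL2_eq_toLp hg, toL2_eq_toLp (add_mem hf hg)]; rfl

theorem toL2_smul (c : ℝ) {f : Ω → ℝ} (hf : f ∈ memLpTwo μ) :
    toL2 μ (c • f) = c • toL2 μ f := by
  rw [toL2_eq_toLp hf, toL2_eq_toLp (Submodule.smul_mem _ c hf)]; rfl

variable (μ) in
/-- The class map as a linear map. -/
def toL2Lin : memLpTwo μ →ₗ[ℝ] Lp ℝ 2 μ where
  toFun f := toL2 μ f
  map_add' f g := toL2_add f.2 g.2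
  map_smul' c f := toL2_smul c f.2

theorem toL2_sub {f g : Ω → ℝ} (hf : f ∈ memLpTwo μ) (hg : g ∈ memLpTwo μ) :
    toL2 μ (f - g) = toL2 μ f - toL2 μ g :=
  map_sub (toL2Lin μ) ⟨f, hf⟩ ⟨g, hg⟩

theorem toL2_sum [Fintype ι] {x : ι → Ω → ℝ} (hx : ∀ j, x j ∈ memLpTwo μ) (c : ι → ℝ) :
    toL2 μ (∑ j, c j • x j) = ∑ j, c j • toL2 μ (x j) := by
  have := map_sum (toL2Lin μ) (fun j => c j • (⟨x j, hx j⟩ : memLpTwo μ)) Finset.univ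
  simp only [map_smul] at this
  refine Eq.trans ?_ this
  change _ = toL2 μ (((∑ j, c j • (⟨x j, hx j⟩ : memLpTwo μ) : memLpTwo μ)) : Ω → ℝ)
  congr 1
  simp

theorem toL2_act [Fintype κ] [Fintype ι] (A : Matrix κ ι ℝ) {x : ι → Ω → ℝ}
    (hx : ∀ j, x j ∈ memLpTwo μ) (i : κ) :
    toL2 μ (act A x i) = act A (fun j => toL2 μ (x j)) i :=
  toL2_sum hx (A i)

theorem toL2_congr {f g : Ω → ℝ} (h : f =ᵐ[μ] g) : toL2 μ f = toL2 μ g := by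
  by_cases hf : MemLp f 2 μ
  · have hg : MemLp g 2 μ := (memLp_congr_ae h).1 hf
    rw [toL2_eq_toLp hf, toL2_eq_toLp hg]
    exact MemLp.toLp_congr _ _ h
  · have hg : ¬ MemLp g 2 μ := fun h' => hf ((memLp_congr_ae h).2 h')
    rw [toL2, toL2, dif_neg hf, dif_neg hg]

theorem toL2_eq_iff {f g : Ω → ℝ} (hf : f ∈ memLpTwo μ) (hg : g ∈ memLpTwo μ) :
    toL2 μ f = toL2 μ g ↔ f =ᵐ[μ] g := by
  rw [toL2_eq_toLp hf, toL2_eq_toLp hg]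
  exact MemLp.toLp_eq_toLp_iff _ _

theorem inner_toL2 {f g : Ω → ℝ} (hf : f ∈ memLpTwo μ) (hg : g ∈ memLpTwo μ) :
    inner ℝ (toL2 μ f) (toL2 μ g) = ∫ ω, f ω * g ω ∂μ := by
  rw [L2.inner_def]
  refine integral_congr_ae ?_
  filter_upwards [coeFn_toL2 hf, coeFn_toL2 hg] with ω h1 h2
  rw [h1, h2]
  simp [mul_comm]

theorem funSpan_le_memLpTwo {f : Ω → ι → ℝ} (hf : ∀ k, MemLp (fun ω => f ω k) 2 μ) :
    funSpan f ≤ memLpTwo μ :=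
  funSpan_le_iff.2 hf

theorem toL2_mem_spanL2 {f : Ω → ι → ℝ} (hf : funSpan f ≤ memLpTwo μ) {g : Ω → ℝ}
    (hg : g ∈ funSpan f) : toL2 μ g ∈ spanL2 μ f := by
  -- `toL2` is linear only on `memLpTwo`, so the preimage of the span is formed there and then
  -- pushed forward to functions.
  have : funSpan f ≤ ((spanL2 μ f).comap (toL2Lin μ)).map (memLpTwo μ).subtype := by
    refine funSpan_le_iff.2 fun k => ?_
    exact ⟨⟨_, hf (coord_mem_funSpan f k)⟩, Submodule.subset_span ⟨k, rfl⟩, rfl⟩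
  obtain ⟨g', hg', rfl⟩ := this hg
  exact hg'

theorem exists_mem_funSpan [Fintype ι] {f : Ω → ι → ℝ} (hf : funSpan f ≤ memLpTwo μ)
    {x : Lp ℝ 2 μ} (hx : x ∈ spanL2 μ f) : ∃ g ∈ funSpan f, toL2 μ g = x := by
  obtain ⟨c, rfl⟩ := (Submodule.mem_span_range_iff_exists_fun ℝ).1 hx
  refine ⟨∑ k, c k • fun ω => f ω k,
    sum_mem fun k _ => Submodule.smul_mem _ _ (coord_mem_funSpan f k), ?_⟩
  exact toL2_sum (fun k => hf (coord_mem_funSpan f k)) c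

theorem spanL2_mono {f : Ω → ι → ℝ} {g : Ω → κ → ℝ} (hg : funSpan g ≤ memLpTwo μ)
    (h : funSpan f ≤ funSpan g) : spanL2 μ f ≤ spanL2 μ g := by
  refine Submodule.span_le.2 ?_
  rintro _ ⟨k, rfl⟩
  exact toL2_mem_spanL2 hg (h (coord_mem_funSpan f k))

end Classes

/-! ### Independence of the agents -/

section Agents

variable {M : Model n} (P : Noise M Ω) {μ : Measure Ω} [IsProbabilityMeasure μ]

/-- The agent to which a primitive random vector belongs. -/
def Primitive.agent {N : ℕ} : Primitive n N → Fin (n + 1)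
  | .init i => i
  | .w i _ => i
  | .v i _ => i.succ

/-- The coordinates of all primitive random vectors of an agent. -/
def agentPrim (j : Fin (n + 1)) (ω : Ω) :
    (Σ p : {p : Primitive n M.N // p.agent = j}, Fin (M.primDim p)) → ℝ :=
  fun k => P.prim k.1 ω k.2

theorem init_mem_agentPrim (j : Fin (n + 1)) (a : Fin (M.dx j)) :
    (fun ω => P.init j ω a) ∈ funSpan (agentPrim P j) :=
  coord_mem_funSpan (agentPrim P j) ⟨⟨.init j, rfl⟩, a⟩

theorem w_mem_agentPrim (j : Fin (n + 1)) {t : ℕ} (ht : t ≤ M.N) (a : Fin (M.dx j)) :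
    (fun ω => P.w j t ω a) ∈ funSpan (agentPrim P j) :=
  coord_mem_funSpan (agentPrim P j) ⟨⟨.w j ⟨t, Nat.lt_succ_of_le ht⟩, rfl⟩, a⟩

theorem v_mem_agentPrim (i : Fin n) {t : ℕ} (ht : t ≤ M.N) (b : Fin (M.dy i)) :
    (fun ω => P.v i t ω b) ∈ funSpan (agentPrim P i.succ) :=
  coord_mem_funSpan (agentPrim P i.succ) ⟨⟨.v i ⟨t, Nat.lt_succ_of_le ht⟩, rfl⟩, b⟩

theorem majorPrim_le_agentPrim {t : ℕ} (ht : t ≤ M.N + 1) :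
    funSpan (majorPrim P t) ≤ funSpan (agentPrim P 0) := by
  refine funSpan_le_iff.2 ?_
  rintro (a | ⟨s, a⟩)
  · exact init_mem_agentPrim P 0 a
  · exact w_mem_agentPrim P 0 (by have := s.2; omega) a

theorem freeState_mem_agentPrim (i : Fin n) {t : ℕ} (ht : t ≤ M.N + 1) (a : Fin (M.dx i.succ)) :
    (fun ω => freeState P i t ω a) ∈ funSpan (agentPrim P i.succ) := by
  induction t generalizing a with
  | zero => exact init_mem_agentPrim P i.succ a
  | succ t ih =>
    rw [coord_freeState_succ]
    exact add_mem (act_mem _ (fun b => ih (by omega) b) a)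
      (w_mem_agentPrim P i.succ (by omega) a)

theorem minorPrim_le_agentPrim (i : Fin n) {t : ℕ} (ht : t ≤ M.N + 1) :
    funSpan (minorPrim P i t) ≤ funSpan (agentPrim P i.succ) := by
  refine funSpan_le_iff.2 ?_
  rintro ⟨s, b⟩
  have hs : (s : ℕ) ≤ M.N := by have := s.2; omega
  change (fun ω => freeOutput P i s ω b) ∈ _
  rw [coord_freeOutput]
  exact add_mem (act_mem _ (fun a => freeState_mem_agentPrim P i (by omega) a) b)
    (v_mem_agentPrim P i hs b)

theorem withOne_le_memLpTwo {ι : Type*} {f : Ω → ι → ℝ} (hf : funSpan f ≤ memLpTwo μ) :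
    funSpan (withOne f) ≤ memLpTwo μ :=
  withOne_le_iff.2 ⟨memLp_const 1, hf⟩

/-- The σ-algebra generated by the primitive random vectors of an agent. -/
abbrev agentSigma (j : Fin (n + 1)) : MeasurableSpace Ω :=
  ⨆ p ∈ {p : Primitive n M.N | p.agent = j}, MeasurableSpace.comap (P.prim p) inferInstance

variable {P} (hP : P.Admissible μ)

include hP

theorem agentPrim_le_memLpTwo (j : Fin (n + 1)) : funSpan (agentPrim P j) ≤ memLpTwo μ :=
  funSpan_le_memLpTwo fun k => hP.memLp_two k.1 k.2

/-- Independence factors the expectation of the product and the zero means kill it. All later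
orthogonality between distinct primitive vectors comes from here. -/
theorem inner_prim {p q : Primitive n M.N} (h : p ≠ q) (a : Fin (M.primDim p))
    (b : Fin (M.primDim q)) :
    inner ℝ (toL2 μ fun ω => P.prim p ω a) (toL2 μ fun ω => P.prim q ω b) = 0 := by
  rw [inner_toL2 (hP.memLp_two p a) (hP.memLp_two q b)]
  have h1 : IndepFun (fun ω => P.prim p ω a) (fun ω => P.prim q ω b) μ :=
    (hP.indep.indepFun h).comp (measurable_pi_apply a) (measurable_pi_apply b)
  have h2 := h1.integral_fun_mul_eq_mul_integral (hP.memLp_two p a).aestronglyMeasurable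
    (hP.memLp_two q b).aestronglyMeasurable
  rw [h2, hP.mean_zero, zero_mul]

theorem inner_one_prim (p : Primitive n M.N) (a : Fin (M.primDim p)) :
    inner ℝ (toL2 μ fun _ => (1 : ℝ)) (toL2 μ fun ω => P.prim p ω a) = 0 := by
  rw [inner_toL2 (memLp_const 1) (hP.memLp_two p a)]
  simpa using hP.mean_zero p a

theorem agentPrim_isOrtho {j k : Fin (n + 1)} (h : j ≠ k) :
    spanL2 μ (agentPrim P j) ⟂ spanL2 μ (agentPrim P k) := by
  refine Submodule.isOrtho_span.2 ?_
  rintro _ ⟨⟨⟨p, rfl⟩, a⟩, rfl⟩ _ ⟨⟨⟨q, rfl⟩, b⟩, rfl⟩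
  exact inner_prim hP (fun e : p = q => h (congrArg Primitive.agent e)) a b

theorem inner_one_of_mem_agentPrim {j : Fin (n + 1)} {x : Lp ℝ 2 μ}
    (hx : x ∈ spanL2 μ (agentPrim P j)) : inner ℝ (toL2 μ fun _ => (1 : ℝ)) x = 0 := by
  have : spanL2 μ (agentPrim P j) ≤ (ℝ ∙ toL2 μ fun _ : Ω => (1 : ℝ))ᗮ := by
    refine Submodule.span_le.2 ?_
    rintro _ ⟨⟨⟨p, rfl⟩, a⟩, rfl⟩
    exact Submodule.mem_orthogonal_singleton_iff_inner_right.2 (inner_one_prim hP p a)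
  exact Submodule.mem_orthogonal_singleton_iff_inner_right.1 (this hx)

theorem agentSigma_le (j : Fin (n + 1)) : agentSigma P j ≤ ‹MeasurableSpace Ω› :=
  iSup₂_le fun p _ => (hP.measurable p).comap_le

/-- Orthogonality suffices for the projections, but the conditional expectation defining $u^c$ needs
independence of σ-algebras. -/
theorem indep_agentSigma {j k : Fin (n + 1)} (h : j ≠ k) :
    Indep (agentSigma P j) (agentSigma P k) μ := by
  refine indep_iSup_of_disjoint (fun p => (hP.measurable p).comap_le) hP.indep.iIndep ?_
  rw [Set.disjoint_left]
  intro p hp hq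
  exact h (hp.symm.trans hq)

theorem integral_eq_zero_of_mem_agentPrim {j : Fin (n + 1)} {f : Ω → ℝ}
    (hf : f ∈ funSpan (agentPrim P j)) : ∫ ω, f ω ∂μ = 0 := by
  have h := inner_one_of_mem_agentPrim hP (toL2_mem_spanL2 (agentPrim_le_memLpTwo hP j) hf)
  rw [inner_toL2 (memLp_const 1) (agentPrim_le_memLpTwo hP j hf)] at h
  simpa using h

end Agents

/-! ### Conditional expectation given the common information -/

section Conditioning

/-- The space of measurable functions. -/
def measurableSubmodule (m : MeasurableSpace Ω) : Submodule ℝ (Ω → ℝ) where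
  carrier := {f | Measurable[m] f}
  add_mem' hf hg := Measurable.add hf hg
  zero_mem' := measurable_const
  smul_mem' c _ hf := Measurable.const_smul hf c

variable {M : Model n} (P : Noise M Ω) {μ : Measure Ω} [IsProbabilityMeasure μ]

theorem agentPrim_le_measurable (j : Fin (n + 1)) :
    funSpan (agentPrim P j) ≤ measurableSubmodule (agentSigma P j) := by
  refine funSpan_le_iff.2 ?_
  rintro ⟨⟨p, hp⟩, a⟩
  have h1 : Measurable[MeasurableSpace.comap (P.prim p) inferInstance] (P.prim p) :=
    comap_measurable _
  have h2 : MeasurableSpace.comap (P.prim p) inferInstance ≤ agentSigma P j :=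
    le_iSup₂_of_le p hp le_rfl
  exact (measurable_pi_apply a).comp (h1.mono h2 le_rfl)

/-- Such a function is an affine, hence continuous, function of the information itself. -/
theorem majorSpan_measurable_majorInfo (u : Control M Ω) {t : ℕ} {f : Ω → ℝ}
    (hf : f ∈ majorSpan P t) :
    Measurable[MeasurableSpace.comap (majorInfo P u t) inferInstance] f := by
  obtain ⟨φ, hφ⟩ := majorSpan_realizable P hf
  have h1 : Measurable φ := φ.continuous_of_finiteDimensional.measurable
  have h2 : f = fun ω => φ (majorInfo P u t ω) := funext fun ω => hφ u ω
  rw [h2]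
  exact h1.comp (comap_measurable _)

theorem comap_majorInfo_le (g : AffineStrategy M) {t : ℕ} (ht : t ≤ M.N + 1) :
    MeasurableSpace.comap (majorInfo P (g.control P) t) inferInstance ≤ agentSigma P 0 := by
  have h0 : majorSpan P t ≤ measurableSubmodule (agentSigma P 0) :=
    withOne_le_iff.2 ⟨measurable_const,
      (majorPrim_le_agentPrim P ht).trans (agentPrim_le_measurable P 0)⟩
  have h : Measurable[agentSigma P 0] (majorInfo P (g.control P) t) :=
    (@measurable_pi_iff _ _ _ (agentSigma P 0) _ _).2 fun k => h0 (majorInfo_mem_majorSpan P g t k)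
  exact h.comap_le

/-- The conditional expectation given the common information removes the part that depends on
the primitive random variables of a minor agent. -/
theorem condExp_add_minorPrim (hP : P.Admissible μ) (g : AffineStrategy M) {t : ℕ} (ht : t ≤ M.N)
    (i : Fin n) {f k : Ω → ℝ} (hf : f ∈ majorSpan P t) (hk : k ∈ funSpan (minorPrim P i (t + 1))) :
    μ[f + k | MeasurableSpace.comap (majorInfo P (g.control P) t) inferInstance] =ᵐ[μ] f := by
  have hmle := comap_majorInfo_le P g (t := t) (by omega)
  have hle := hmle.trans (agentSigma_le hP 0)
  have hk' : k ∈ funSpan (agentPrim P i.succ) := minorPrim_le_agentPrim P i (by omega) hk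
  have hfL : MemLp f 2 μ := withOne_le_memLpTwo
    ((majorPrim_le_agentPrim P (by omega)).trans (agentPrim_le_memLpTwo hP 0)) hf
  have hkL : MemLp k 2 μ := agentPrim_le_memLpTwo hP i.succ hk'
  have hfi : Integrable f μ := hfL.integrable (by norm_num)
  have hki : Integrable k μ := hkL.integrable (by norm_num)
  have h1 := condExp_of_stronglyMeasurable hle
    (majorSpan_measurable_majorInfo P (g.control P) hf).stronglyMeasurable hfi
  have hind := indep_of_indep_of_le_right (indep_agentSigma hP (Fin.succ_ne_zero i)) hmle
  have h2 := condExp_indep_eq (agentSigma_le hP _) hle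
    (Measurable.stronglyMeasurable (agentPrim_le_measurable P i.succ hk')) hind
  filter_upwards [condExp_add hfi hki _, h2] with ω e1 e2
  rw [e1, Pi.add_apply, e2, h1, integral_eq_zero_of_mem_agentPrim hP hk', add_zero]

theorem condExp_majorSpan (hP : P.Admissible μ) (g : AffineStrategy M) {t : ℕ} (ht : t ≤ M.N)
    {f : Ω → ℝ} (hf : f ∈ majorSpan P t) :
    μ[f | MeasurableSpace.comap (majorInfo P (g.control P) t) inferInstance] =ᵐ[μ] f := by
  have hfL : MemLp f 2 μ := withOne_le_memLpTwo
    ((majorPrim_le_agentPrim P (by omega)).trans (agentPrim_le_memLpTwo hP 0)) hf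
  rw [condExp_of_stronglyMeasurable ((comap_majorInfo_le P g (by omega)).trans
    (agentSigma_le hP 0)) (majorSpan_measurable_majorInfo P _ hf).stronglyMeasurable
    (hfL.integrable (by norm_num))]

end Conditioning

end MajorMinor

namespace MajorMinor

variable {n : ℕ} {Ω : Type*} [MeasurableSpace Ω]

/-! ### Orthogonal projections and orthogonal sums -/

section Projection

variable {E : Type*} [NormedAddCommGroup E] [InnerProductSpace ℝ E]
  {K : Submodule ℝ E} [K.HasOrthogonalProjection]

theorem starProjection_eq_zero {x : E} (hx : x ∈ Kᗮ) : K.starProjection x = 0 :=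
  Submodule.eq_starProjection_of_mem_orthogonal K.zero_mem (by simpa using hx)

theorem starProjection_congr {x y : E} (h : x - y ∈ Kᗮ) :
    K.starProjection x = K.starProjection y := by
  rw [← sub_eq_zero, ← map_sub, starProjection_eq_zero h]

theorem starProjection_add_of_mem {x y : E} (hx : x ∈ K) (hy : y ∈ Kᗮ) :
    K.starProjection (x + y) = x := by
  rw [map_add, starProjection_eq_zero hy, Submodule.starProjection_eq_self_iff.2 hx, add_zero]

theorem sub_starProjection_mem_of_mem_sup {G : Submodule ℝ E} (hG : G ≤ Kᗮ) {x : E}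
    (hx : x ∈ K ⊔ G) : x - K.starProjection x ∈ G := by
  obtain ⟨f, hf, k, hk, rfl⟩ := Submodule.mem_sup.1 hx
  rw [starProjection_add_of_mem hf (hG hk)]
  simpa using hk

end Projection

/-! ### Quadratic forms with orthogonal blocks -/

section Blocks

variable {d e : Fin (n + 1) → ℕ}

theorem diagBlock_posSemidef {S : Matrix (Stacked d) (Stacked d) ℝ} (hS : S.PosSemidef)
    (i : Fin (n + 1)) : (diagBlock S i).PosSemidef :=
  hS.submatrix (Sigma.mk i)

theorem diagBlock_posDef {S : Matrix (Stacked d) (Stacked d) ℝ} (hS : S.PosDef)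
    (i : Fin (n + 1)) : (diagBlock S i).PosDef :=
  hS.submatrix sigma_mk_injective

variable {E : Type*} [NormedAddCommGroup E] [InnerProductSpace ℝ E]

/-- A quadratic form in a vector whose blocks are pairwise orthogonal. -/
theorem ip_act_of_ortho_blocks (S : Matrix (Stacked d) (Stacked d) ℝ) {y : Stacked d → E}
    {G : Fin n → Submodule ℝ E} (hG : ∀ i j, i ≠ j → G i ⟂ G j) (h0 : ∀ a, y ⟨0, a⟩ = 0)
    (hy : ∀ i a, y ⟨Fin.succ i, a⟩ ∈ G i) :
    ip y (act S y) = ∑ i : Fin n, ip (fun a => y ⟨i.succ, a⟩)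
      (act (diagBlock S i.succ) fun a => y ⟨i.succ, a⟩) := by
  rw [ip, Fintype.sum_sigma, Fin.sum_univ_succ]
  simp only [h0, inner_zero_left, Finset.sum_const_zero, zero_add]
  refine Finset.sum_congr rfl fun i _ => Finset.sum_congr rfl fun a _ => ?_
  simp only [act, inner_sum]
  rw [Fintype.sum_sigma, Fin.sum_univ_succ, Finset.sum_eq_single i]
  · simp [h0, diagBlock]
  · intro j _ hj
    refine Finset.sum_eq_zero fun b _ => ?_
    rw [inner_smul_right, (hG i j (Ne.symm hj)).inner_eq (hy i a) (hy j b), mul_zero]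
  · simp

/-- Splitting of a quadratic form along an orthogonal projection whose residual has pairwise
orthogonal blocks. -/
theorem ip_act_split (S : Matrix (Stacked d) (Stacked d) ℝ) (hS : S.PosSemidef)
    {x : Stacked d → E} {K : Submodule ℝ E} [K.HasOrthogonalProjection]
    {G : Fin n → Submodule ℝ E} (hG : ∀ i j, i ≠ j → G i ⟂ G j) (hK : ∀ i, G i ≤ Kᗮ)
    (h0 : ∀ a, x ⟨0, a⟩ ∈ K) (hx : ∀ i a, x ⟨Fin.succ i, a⟩ ∈ K ⊔ G i) :
    ip x (act S x) =
      ip (fun p => K.starProjection (x p)) (act S fun p => K.starProjection (x p)) +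
      ∑ i : Fin n,
        ip (fun a => x ⟨i.succ, a⟩ - K.starProjection (x ⟨i.succ, a⟩))
          (act (diagBlock S i.succ)
            fun a => x ⟨i.succ, a⟩ - K.starProjection (x ⟨i.succ, a⟩)) := by
  set y : Stacked d → E := fun p => x p - K.starProjection (x p) with hy
  have hblocks := ip_act_of_ortho_blocks S (y := y) hG
    (fun a => by simp [hy, Submodule.starProjection_eq_self_iff.2 (h0 a)])
    (fun i a => sub_starProjection_mem_of_mem_sup (hK i) (hx i a))
  have hsum : x = (fun p => K.starProjection (x p)) + y := by
    funext p; simp [hy]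
  have hcross : ip (fun p => K.starProjection (x p)) (act S y) = 0 :=
    ip_eq_zero_of_orthogonal (fun p => Submodule.starProjection_apply_mem _ _)
      (act_mem S fun p => Submodule.sub_starProjection_mem_orthogonal _)
  have hcross' : ip y (act S fun p => K.starProjection (x p)) = 0 := by
    rw [ip_act_symm (transpose_eq_of_posSemidef hS), hcross]
  rw [← hblocks]
  conv_lhs => rw [hsum]
  rw [act_add, ip_add_left, ip_add_right, ip_add_right, hcross, hcross']
  ring

end Blocks

/-! ### Trajectories in `L²` -/

section Spaces

variable {M : Model n} (P : Noise M Ω) (μ : Measure Ω)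

/-- Classes of affine functions of the primitive random variables of the major agent before `t`. -/
abbrev commonSpace (t : ℕ) : Submodule ℝ (Lp ℝ 2 μ) := spanL2 μ (withOne (majorPrim P t))

/-- Classes of linear functions of the control-free outputs of a minor agent before `t`. -/
abbrev localSpace (i : Fin n) (t : ℕ) : Submodule ℝ (Lp ℝ 2 μ) := spanL2 μ (minorPrim P i t)

/-- Classes of linear functions of the primitive random variables of an agent. -/
abbrev agentSpace (j : Fin (n + 1)) : Submodule ℝ (Lp ℝ 2 μ) := spanL2 μ (agentPrim P j)

/-- The class of the process noise. -/
def noiseL2 (t : ℕ) (p : Stacked M.dx) : Lp ℝ 2 μ := toL2 μ fun ω => P.W t ω p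

/-- The class of the initial state. -/
def initL2 (p : Stacked M.dx) : Lp ℝ 2 μ := toL2 μ fun ω => P.x₁ ω p

theorem commonSpace_mono : Monotone (commonSpace P μ) := fun s t h => by
  refine Submodule.span_le.2 ?_
  rintro _ ⟨_ | a | ⟨r, a⟩, rfl⟩
  · exact Submodule.subset_span ⟨none, rfl⟩
  · exact Submodule.subset_span ⟨some (Sum.inl a), rfl⟩
  · exact Submodule.subset_span ⟨some (Sum.inr (⟨r, r.2.trans_le h⟩, a)), rfl⟩

theorem localSpace_mono (i : Fin n) : Monotone (localSpace P μ i) := fun s t h => by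
  refine Submodule.span_le.2 ?_
  rintro _ ⟨⟨r, a⟩, rfl⟩
  exact Submodule.subset_span ⟨(⟨r, r.2.trans_le h⟩, a), rfl⟩

theorem one_mem_commonSpace (t : ℕ) : (toL2 μ fun _ => (1 : ℝ)) ∈ commonSpace P μ t :=
  Submodule.subset_span ⟨none, rfl⟩

variable {P μ} [IsProbabilityMeasure μ] (hP : P.Admissible μ)

include hP

theorem majorSpan_le_memLpTwo {t : ℕ} (ht : t ≤ M.N + 1) : majorSpan P t ≤ memLpTwo μ :=
  withOne_le_memLpTwo ((majorPrim_le_agentPrim P ht).trans (agentPrim_le_memLpTwo hP 0))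

theorem minorPrim_le_memLpTwo (i : Fin n) {t : ℕ} (ht : t ≤ M.N + 1) :
    funSpan (minorPrim P i t) ≤ memLpTwo μ :=
  (minorPrim_le_agentPrim P i ht).trans (agentPrim_le_memLpTwo hP _)

theorem commonSpace_le {t : ℕ} (ht : t ≤ M.N + 1) {V : Submodule ℝ (Lp ℝ 2 μ)}
    (h1 : (toL2 μ fun _ => (1 : ℝ)) ∈ V) (h0 : agentSpace P μ 0 ≤ V) :
    commonSpace P μ t ≤ V := by
  refine Submodule.span_le.2 ?_
  rintro _ ⟨_ | k, rfl⟩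
  · exact h1
  · exact h0 (toL2_mem_spanL2 (agentPrim_le_memLpTwo hP 0)
      (majorPrim_le_agentPrim P ht (coord_mem_funSpan _ k)))

theorem localSpace_le_agentSpace (i : Fin n) {t : ℕ} (ht : t ≤ M.N + 1) :
    localSpace P μ i t ≤ agentSpace P μ i.succ :=
  spanL2_mono (agentPrim_le_memLpTwo hP _) (minorPrim_le_agentPrim P i ht)

/-- The primitives of a minor agent are orthogonal to those of the major agent by independence and
to the constants by their zero mean. -/
theorem agentSpace_le_commonSpace_orthogonal (i : Fin n) {t : ℕ} (ht : t ≤ M.N + 1) :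
    agentSpace P μ i.succ ≤ (commonSpace P μ t)ᗮ := by
  have h : commonSpace P μ t ≤ (agentSpace P μ i.succ)ᗮ := by
    refine commonSpace_le hP ht ?_ (agentPrim_isOrtho hP (Fin.succ_ne_zero i).symm)
    exact (Submodule.mem_orthogonal' _ _).2 fun x hx => inner_one_of_mem_agentPrim hP hx
  exact (Submodule.le_orthogonal_orthogonal _).trans (Submodule.orthogonal_le h)

theorem localSpace_le_commonSpace_orthogonal (i : Fin n) {t s : ℕ} (ht : t ≤ M.N + 1)
    (hs : s ≤ M.N + 1) : localSpace P μ i s ≤ (commonSpace P μ t)ᗮ :=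
  (localSpace_le_agentSpace hP i hs).trans (agentSpace_le_commonSpace_orthogonal hP i ht)

theorem noiseL2_mem_agentSpace {t : ℕ} (ht : t ≤ M.N) (j : Fin (n + 1)) (a : Fin (M.dx j)) :
    noiseL2 P μ t ⟨j, a⟩ ∈ agentSpace P μ j :=
  toL2_mem_spanL2 (agentPrim_le_memLpTwo hP j) (w_mem_agentPrim P j ht a)

theorem initL2_mem_agentSpace (j : Fin (n + 1)) (a : Fin (M.dx j)) :
    initL2 P μ ⟨j, a⟩ ∈ agentSpace P μ j :=
  toL2_mem_spanL2 (agentPrim_le_memLpTwo hP j) (init_mem_agentPrim P j a)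

omit hP in
theorem initL2_mem_commonSpace (t : ℕ) (a : Fin (M.dx 0)) :
    initL2 P μ ⟨0, a⟩ ∈ commonSpace P μ t :=
  Submodule.subset_span ⟨some (Sum.inl a), rfl⟩

omit hP in
theorem noiseL2_mem_commonSpace {s t : ℕ} (h : s < t) (a : Fin (M.dx 0)) :
    noiseL2 P μ s ⟨0, a⟩ ∈ commonSpace P μ t :=
  Submodule.subset_span ⟨some (Sum.inr (⟨s, h⟩, a)), rfl⟩

/-- The process noise is orthogonal to the past of the major agent. -/
theorem noiseL2_mem_commonSpace_orthogonal {t : ℕ} (ht : t ≤ M.N) (p : Stacked M.dx) :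
    noiseL2 P μ t p ∈ (commonSpace P μ t)ᗮ := by
  obtain ⟨j, a⟩ := p
  rw [Submodule.mem_orthogonal]
  have key : commonSpace P μ t ≤ (ℝ ∙ noiseL2 P μ t ⟨j, a⟩)ᗮ := by
    refine Submodule.span_le.2 ?_
    rintro _ ⟨_ | b | ⟨r, b⟩, rfl⟩ <;>
      refine Submodule.mem_orthogonal_singleton_iff_inner_left.2 ?_
    · exact inner_one_of_mem_agentPrim hP (noiseL2_mem_agentSpace hP ht j a)
    · exact inner_prim hP (p := .init 0) (q := .w j ⟨t, by omega⟩) (by simp) b a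
    · refine inner_prim hP (p := .w 0 ⟨r, by omega⟩) (q := .w j ⟨t, by omega⟩) ?_ b a
      intro h
      have := r.2
      simp only [Primitive.w.injEq, Fin.mk.injEq] at h
      omega
  intro x hx
  exact Submodule.mem_orthogonal_singleton_iff_inner_left.1 (key hx)

/-- The process noise of a minor agent is orthogonal to its current control-free outputs. -/
theorem noiseL2_mem_localSpace_orthogonal {t : ℕ} (ht : t ≤ M.N) (i : Fin n)
    (a : Fin (M.dx i.succ)) :
    noiseL2 P μ t ⟨i.succ, a⟩ ∈ (localSpace P μ i (t + 1))ᗮ := by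
  set x := noiseL2 P μ t ⟨i.succ, a⟩ with hx
  -- `V` consists of the square integrable functions whose class is orthogonal to the noise. Working
  -- with functions allows the recursion for `freeState` to be followed; it meets only earlier
  -- process noises, and the current observation noise is a different primitive.
  let V : Submodule ℝ (Ω → ℝ) := ((ℝ ∙ x)ᗮ.comap (toL2Lin μ)).map (memLpTwo μ).subtype
  have hprim : ∀ (p : Primitive n M.N) (b : Fin (M.primDim p)),
      p ≠ .w i.succ ⟨t, Nat.lt_succ_of_le ht⟩ → (fun ω => P.prim p ω b) ∈ V := fun p b h =>
    ⟨⟨_, hP.memLp_two p b⟩, Submodule.mem_orthogonal_singleton_iff_inner_left.2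
      (inner_prim hP (q := .w i.succ ⟨t, Nat.lt_succ_of_le ht⟩) h b a), rfl⟩
  have hstate : ∀ s ≤ t, ∀ b, (fun ω => freeState P i s ω b) ∈ V := by
    intro s
    induction s with
    | zero => exact fun _ b => hprim (.init i.succ) b (by simp)
    | succ s ih =>
      intro hs b
      rw [coord_freeState_succ]
      refine add_mem (act_mem _ (ih (by omega)) b)
        (hprim (.w i.succ ⟨s, by omega⟩) b fun h => ?_)
      simp only [Primitive.w.injEq, Fin.mk.injEq] at h
      omega
  have hV : funSpan (minorPrim P i (t + 1)) ≤ V := by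
    refine funSpan_le_iff.2 ?_
    rintro ⟨s, b⟩
    change (fun ω => freeOutput P i s ω b) ∈ V
    have hs := s.2
    rw [coord_freeOutput]
    exact add_mem (act_mem _ (hstate s (by omega)) b)
      (hprim (.v i ⟨s, by omega⟩) b (by simp))
  have key : localSpace P μ i (t + 1) ≤ (ℝ ∙ x)ᗮ := by
    refine Submodule.span_le.2 ?_
    rintro _ ⟨k, rfl⟩
    obtain ⟨f, hf, hfk⟩ := hV (coord_mem_funSpan (minorPrim P i (t + 1)) k)
    change toL2 μ (fun ω => minorPrim P i (t + 1) ω k) ∈ (ℝ ∙ x)ᗮ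
    rw [← hfk]
    exact hf
  exact (Submodule.mem_orthogonal _ _).2 fun y hy =>
    Submodule.mem_orthogonal_singleton_iff_inner_left.1 (key hy)

end Spaces

end MajorMinor

namespace MajorMinor

variable {n : ℕ} {Ω : Type*} [MeasurableSpace Ω]

/-! ### Decoupling of the cost and optimal feedback -/

section Trajectories

variable {M : Model n} (P : Noise M Ω) (μ : Measure Ω)

/-- State and control processes in `L²` that obey the dynamics and the information constraints. -/
structure IsTrajectory (X : ℕ → Stacked M.dx → Lp ℝ 2 μ) (U : ℕ → Stacked M.du → Lp ℝ 2 μ) :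
    Prop where
  init : X 0 = initL2 P μ
  step : ∀ t < M.N, X (t + 1) = act M.A (X t) + act M.B (U t) + noiseL2 P μ t
  major : ∀ t < M.N, ∀ a, U t ⟨0, a⟩ ∈ commonSpace P μ t
  minor : ∀ t < M.N, ∀ (i : Fin n) (a),
    U t ⟨i.succ, a⟩ ∈ commonSpace P μ t ⊔ localSpace P μ i (t + 1)

/-- Projection onto the affine functions of the primitive random variables of the major agent. -/
abbrev commonProj : Lp ℝ 2 μ →L[ℝ] Lp ℝ 2 μ := (commonSpace P μ M.N).starProjection

/-- Deviation of the common control from its optimal feedback. -/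
def commonResidual (t : ℕ) (x : Stacked M.dx → Lp ℝ 2 μ) (u : Stacked M.du → Lp ℝ 2 μ) :
    Stacked M.du → Lp ℝ 2 μ :=
  (fun p => commonProj P μ (u p)) +
    act (M.Lc t) fun p => (commonSpace P μ t).starProjection (x p)

/-- Deviation of the local control of a minor agent from its optimal feedback. -/
def localResidual (i : Fin n) (t : ℕ) (x : Stacked M.dx → Lp ℝ 2 μ)
    (u : Stacked M.du → Lp ℝ 2 μ) : Fin (M.du i.succ) → Lp ℝ 2 μ :=
  (fun a => u ⟨i.succ, a⟩ - commonProj P μ (u ⟨i.succ, a⟩)) +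
    act (M.Ll i t) fun a => (localSpace P μ i (t + 1)).starProjection (x ⟨i.succ, a⟩)

/-- The optimal feedback. -/
def feedback (t : ℕ) (x : Stacked M.dx → Lp ℝ 2 μ) : Stacked M.du → Lp ℝ 2 μ := fun p =>
  -act (M.Lc t) (fun q => (commonSpace P μ t).starProjection (x q)) p -
    Fin.cases (motive := fun j => Fin (M.du j) → Lp ℝ 2 μ) 0
      (fun i => act (M.Ll i t) fun b =>
        (localSpace P μ i (t + 1)).starProjection (x ⟨i.succ, b⟩)) p.1 p.2

theorem commonProj_act {a b : Type*} [Fintype a] [Fintype b] (A : Matrix a b ℝ)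
    (x : b → Lp ℝ 2 μ) (p : a) :
    commonProj P μ (act A x p) = act A (fun q => commonProj P μ (x q)) p :=
  map_act (commonProj P μ).toLinearMap A x p

variable {P μ} [IsProbabilityMeasure μ] (hP : P.Admissible μ)
  {X : ℕ → Stacked M.dx → Lp ℝ 2 μ} {U : ℕ → Stacked M.du → Lp ℝ 2 μ}

theorem IsTrajectory.state_major_mem (h : IsTrajectory P μ X U) {t : ℕ} (ht : t ≤ M.N)
    (a : Fin (M.dx 0)) : X t ⟨0, a⟩ ∈ commonSpace P μ t := by
  induction t generalizing a with
  | zero => rw [h.init]; exact initL2_mem_commonSpace 0 a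
  | succ t ih =>
    rw [h.step t (by omega)]
    have hle := commonSpace_mono P μ t.le_succ
    exact add_mem (add_mem
      (act_sparse_zero_mem M.A_sparse (fun b => hle (ih (by omega) b)) a)
      (act_sparse_zero_mem M.B_sparse (fun b => hle (h.major t (by omega) b)) a))
      (noiseL2_mem_commonSpace t.lt_succ_self a)

include hP

/-- No timing is recorded here: splitting the cost needs only that distinct minor agents have
orthogonal local parts. -/
theorem IsTrajectory.state_minor_mem (h : IsTrajectory P μ X U) {t : ℕ} (ht : t ≤ M.N)
    (i : Fin n) (a : Fin (M.dx i.succ)) :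
    X t ⟨i.succ, a⟩ ∈ commonSpace P μ M.N ⊔ agentSpace P μ i.succ := by
  induction t generalizing a with
  | zero =>
    rw [h.init]
    exact le_sup_right (a := commonSpace P μ M.N) (initL2_mem_agentSpace hP _ a)
  | succ t ih =>
    have ht' : t < M.N := by omega
    have hle : commonSpace P μ t ≤ commonSpace P μ M.N ⊔ agentSpace P μ i.succ :=
      (commonSpace_mono P μ ht'.le).trans le_sup_left
    rw [h.step t ht']
    refine add_mem (add_mem
      (act_sparse_succ_mem M.A_sparse i (fun b => hle (h.state_major_mem ht'.le b))
        (fun b => ih ht'.le b) a)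
      (act_sparse_succ_mem M.B_sparse i (fun b => hle (h.major t ht' b)) (fun b => ?_) a))
      (le_sup_right (a := commonSpace P μ M.N) (noiseL2_mem_agentSpace hP ht'.le _ a))
    exact sup_le hle ((localSpace_le_agentSpace hP i (by omega)).trans le_sup_right)
      (h.minor t ht' i b)

theorem commonProj_minor {t : ℕ} (ht : t < M.N) (i : Fin n) {f k : Lp ℝ 2 μ}
    (hf : f ∈ commonSpace P μ t) (hk : k ∈ localSpace P μ i (t + 1)) :
    commonProj P μ (f + k) = f :=
  starProjection_add_of_mem (commonSpace_mono P μ ht.le hf)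
    (localSpace_le_commonSpace_orthogonal hP i (by omega) (by omega) hk)

/-- The part of the control outside `commonSpace t` is orthogonal to the common space of the whole
horizon. Projecting onto that larger space thus uses no future noise, and the common part of the
control stays causal. -/
theorem IsTrajectory.commonProj_mem (h : IsTrajectory P μ X U) {t : ℕ} (ht : t < M.N)
    (p : Stacked M.du) : commonProj P μ (U t p) ∈ commonSpace P μ t := by
  obtain ⟨j, a⟩ := p
  induction j using Fin.cases with
  | zero =>
    rw [Submodule.starProjection_eq_self_iff.2 (commonSpace_mono P μ ht.le (h.major t ht a))]
    exact h.major t ht a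
  | succ i =>
    obtain ⟨f, hf, k, hk, e⟩ := Submodule.mem_sup.1 (h.minor t ht i a)
    rw [← e, commonProj_minor hP ht i hf hk]
    exact hf

theorem IsTrajectory.sub_commonProj_mem (h : IsTrajectory P μ X U) {t : ℕ} (ht : t < M.N)
    (i : Fin n) (a : Fin (M.du i.succ)) :
    U t ⟨i.succ, a⟩ - commonProj P μ (U t ⟨i.succ, a⟩) ∈ localSpace P μ i (t + 1) := by
  obtain ⟨f, hf, k, hk, e⟩ := Submodule.mem_sup.1 (h.minor t ht i a)
  rw [← e, commonProj_minor hP ht i hf hk]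
  simpa using hk

/-- Cross terms between common and local parts, and between different minor agents, vanish by
orthogonality. This holds even for full `Q`, `QT` and `R`, of which the local problems see only the
diagonal blocks. -/
theorem IsTrajectory.quadCost_split (h : IsTrajectory P μ X U) :
    quadCost M.N M.Q M.QT M.R X U =
      quadCost M.N M.Q M.QT M.R (fun t p => commonProj P μ (X t p))
        (fun t p => commonProj P μ (U t p)) +
      ∑ i : Fin n, quadCost M.N (diagBlock M.Q i.succ) (diagBlock M.QT i.succ)
        (diagBlock M.R i.succ)
        (fun t a => X t ⟨i.succ, a⟩ - commonProj P μ (X t ⟨i.succ, a⟩))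
        (fun t a => U t ⟨i.succ, a⟩ - commonProj P μ (U t ⟨i.succ, a⟩)) := by
  have hG : ∀ i j : Fin n, i ≠ j → agentSpace P μ i.succ ⟂ agentSpace P μ j.succ :=
    fun i j hij => agentPrim_isOrtho hP fun e => hij (Fin.succ_injective _ e)
  have hK : ∀ i : Fin n, agentSpace P μ i.succ ≤ (commonSpace P μ M.N)ᗮ :=
    fun i => agentSpace_le_commonSpace_orthogonal hP i (by omega)
  have hX : ∀ (S : Matrix (Stacked M.dx) (Stacked M.dx) ℝ), S.PosSemidef → ∀ t ≤ M.N, _ :=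
    fun S hS t ht => ip_act_split S hS (x := X t) (K := commonSpace P μ M.N) hG hK
      (fun a => commonSpace_mono P μ ht (h.state_major_mem ht a))
      (fun i a => h.state_minor_mem hP ht i a)
  have hU : ∀ t < M.N, _ :=
    fun t ht => ip_act_split M.R M.R_posDef.posSemidef (x := U t) (K := commonSpace P μ M.N) hG hK
      (fun a => commonSpace_mono P μ ht.le (h.major t ht a))
      (fun i a => sup_le_sup (commonSpace_mono P μ ht.le)
        (localSpace_le_agentSpace hP i (by omega)) (h.minor t ht i a))
  simp only [quadCost]
  rw [hX M.QT M.QT_posSemidef M.N le_rfl, Finset.sum_congr rfl fun t ht => by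
    rw [hX M.Q M.Q_posSemidef t (Finset.mem_range.1 ht).le, hU t (Finset.mem_range.1 ht)]]
  simp only [Finset.sum_add_distrib]
  rw [Finset.sum_comm (s := Finset.range M.N) (t := Finset.univ),
    Finset.sum_comm (s := Finset.range M.N) (t := Finset.univ)]
  ring

/-- Completion of squares: the cost of a trajectory is a constant plus positive definite quadratic
forms in the residuals. -/
theorem exists_quadCost_eq : ∃ c : ℝ, ∀ (X : ℕ → Stacked M.dx → Lp ℝ 2 μ)
    (U : ℕ → Stacked M.du → Lp ℝ 2 μ), IsTrajectory P μ X U →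
    quadCost M.N M.Q M.QT M.R X U = c +
      (∑ t ∈ Finset.range M.N, ip (commonResidual P μ t (X t) (U t))
        (act (M.R + M.Bᵀ * M.Sc (t + 1) * M.B) (commonResidual P μ t (X t) (U t))) +
      ∑ i : Fin n, ∑ t ∈ Finset.range M.N, ip (localResidual P μ i t (X t) (U t))
        (act (diagBlock M.R i.succ +
          (diagBlock M.B i.succ)ᵀ * M.Sl i (t + 1) * diagBlock M.B i.succ)
          (localResidual P μ i t (X t) (U t)))) := by
  -- Common problem: after projection the noise of the minor agents vanishes, and $w_0(t)$ is
  -- orthogonal to `commonSpace t`, which contains only earlier $w_0(s)$.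
  obtain ⟨c₀, hc₀⟩ := quadCost_eq M.N M.A M.B M.Q_posSemidef M.QT_posSemidef M.R_posDef
    (fun p => commonProj P μ (initL2 P μ p)) (fun t p => commonProj P μ (noiseL2 P μ t p))
    (commonSpace P μ) (commonSpace_mono P μ) (by
      intro t ht p
      obtain ⟨j, a⟩ := p
      induction j using Fin.cases with
      | zero =>
        rw [Submodule.starProjection_eq_self_iff.2 (noiseL2_mem_commonSpace ht a)]
        exact noiseL2_mem_commonSpace_orthogonal hP ht.le _
      | succ i =>
        rw [starProjection_eq_zero (agentSpace_le_commonSpace_orthogonal hP i (by omega)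
          (noiseL2_mem_agentSpace hP ht.le _ a))]
        exact zero_mem _)
  -- Local problems: the output at $t$ is available at $t$, hence the space `localSpace P μ i (t +
  -- 1)`, to which $w_i(t)$ is still orthogonal.
  have hloc : ∀ i : Fin n, _ := fun i =>
    quadCost_eq M.N (diagBlock M.A i.succ) (diagBlock M.B i.succ)
      (diagBlock_posSemidef M.Q_posSemidef i.succ) (diagBlock_posSemidef M.QT_posSemidef i.succ)
      (diagBlock_posDef M.R_posDef i.succ) (fun a => initL2 P μ ⟨i.succ, a⟩)
      (fun t a => noiseL2 P μ t ⟨i.succ, a⟩) (fun t => localSpace P μ i (t + 1))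
      (fun s t hst => localSpace_mono P μ i (Nat.succ_le_succ hst))
      (fun t ht a => noiseL2_mem_localSpace_orthogonal hP ht.le i a)
  choose c hc using hloc
  refine ⟨c₀ + ∑ i, c i, fun X U h => ?_⟩
  have e₀ := hc₀ (fun t p => commonProj P μ (X t p)) (fun t p => commonProj P μ (U t p))
    (by rw [h.init])
    (fun t ht => by
      funext p
      rw [h.step t ht]
      simp only [Pi.add_apply, map_add]
      rw [commonProj_act, commonProj_act])
    (fun t ht p => h.commonProj_mem hP ht p)
  have hz : ∀ {x : Lp ℝ 2 μ} {i : Fin n}, x ∈ agentSpace P μ i.succ →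
      x - commonProj P μ x = x := fun hx => by
    rw [starProjection_eq_zero (agentSpace_le_commonSpace_orthogonal hP _ (by omega) hx), sub_zero]
  have e₁ : ∀ i, _ := fun i => hc i
    (fun t a => X t ⟨i.succ, a⟩ - commonProj P μ (X t ⟨i.succ, a⟩))
    (fun t a => U t ⟨i.succ, a⟩ - commonProj P μ (U t ⟨i.succ, a⟩))
    (by
      rw [h.init]; funext a
      exact hz (initL2_mem_agentSpace hP _ a))
    (fun t ht => by
      funext a
      set y : Stacked M.dx → Lp ℝ 2 μ := fun p => X t p - commonProj P μ (X t p) with hy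
      set v : Stacked M.du → Lp ℝ 2 μ := fun p => U t p - commonProj P μ (U t p) with hv
      -- The major blocks are purely common. In the local parts they vanish, so the sparse rows
      -- reduce to the diagonal blocks of the minor agent.
      have hy0 : ∀ b, y ⟨0, b⟩ = 0 := fun b => by
        simp only [hy]
        rw [Submodule.starProjection_eq_self_iff.2
          (commonSpace_mono P μ ht.le (h.state_major_mem ht.le b)), sub_self]
      have hv0 : ∀ b, v ⟨0, b⟩ = 0 := fun b => by
        simp only [hv]
        rw [Submodule.starProjection_eq_self_iff.2
          (commonSpace_mono P μ ht.le (h.major t ht b)), sub_self]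
      have h1 := act_sparse_succ M.A_sparse y i a
      have h2 := act_sparse_succ M.B_sparse v i a
      simp only [hy0, hv0, smul_zero, Finset.sum_const_zero, zero_add] at h1 h2
      rw [h.step t ht]
      simp only [Pi.add_apply, map_add]
      rw [← h1, ← h2, ← hz (noiseL2_mem_agentSpace hP ht.le i.succ a)]
      have h3 : act M.A y ⟨i.succ, a⟩ = act M.A (X t) ⟨i.succ, a⟩ -
          commonProj P μ (act M.A (X t) ⟨i.succ, a⟩) := by
        rw [commonProj_act, ← Pi.sub_apply, ← act_sub]; rfl
      have h4 : act M.B v ⟨i.succ, a⟩ = act M.B (U t) ⟨i.succ, a⟩ -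
          commonProj P μ (act M.B (U t) ⟨i.succ, a⟩) := by
        rw [commonProj_act, ← Pi.sub_apply, ← act_sub]; rfl
      rw [h3, h4, hz (noiseL2_mem_agentSpace hP ht.le i.succ a)]
      rw [starProjection_eq_zero (agentSpace_le_commonSpace_orthogonal hP _ (by omega)
        (noiseL2_mem_agentSpace hP ht.le i.succ a))]
      abel)
    (fun t ht a => h.sub_commonProj_mem hP ht i a)
  -- Tower property: the two projections are onto nested spaces.
  have p₀ : ∀ t < M.N, ∀ x : Lp ℝ 2 μ, (commonSpace P μ t).starProjection (commonProj P μ x) =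
      (commonSpace P μ t).starProjection x := fun t ht x =>
    (starProjection_congr (Submodule.orthogonal_le (commonSpace_mono P μ ht.le)
      (Submodule.sub_starProjection_mem_orthogonal x))).symm
  -- The common part is orthogonal to the local space and does not affect the local estimate.
  have p₁ : ∀ t < M.N, ∀ (i : Fin n) (x : Lp ℝ 2 μ),
      (localSpace P μ i (t + 1)).starProjection (x - commonProj P μ x) =
        (localSpace P μ i (t + 1)).starProjection x := fun t ht i x => by
    refine starProjection_congr ?_
    have h1 : commonProj P μ x ∈ commonSpace P μ M.N := Submodule.starProjection_apply_mem _ _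
    have h2 := (Submodule.le_orthogonal_orthogonal _).trans (Submodule.orthogonal_le
      (localSpace_le_commonSpace_orthogonal hP i (t := M.N) (s := t + 1) (by omega) (by omega)))
    have h3 := neg_mem (h2 h1)
    simpa using h3
  have r₀ : ∀ t < M.N, commonResidual P μ t (X t) (U t) = (fun p => commonProj P μ (U t p)) +
      act (M.Lc t) fun p => (commonSpace P μ t).starProjection (commonProj P μ (X t p)) :=
    fun t ht => by simp only [commonResidual, p₀ t ht]
  have r₁ : ∀ (i : Fin n), ∀ t < M.N, localResidual P μ i t (X t) (U t) =
      (fun a => U t ⟨i.succ, a⟩ - commonProj P μ (U t ⟨i.succ, a⟩)) +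
        act (M.Ll i t) fun a => (localSpace P μ i (t + 1)).starProjection
          (X t ⟨i.succ, a⟩ - commonProj P μ (X t ⟨i.succ, a⟩)) :=
    fun i t ht => by simp only [localResidual, p₁ t ht]
  rw [h.quadCost_split hP, e₀, Finset.sum_congr rfl fun i _ => e₁ i, Finset.sum_add_distrib]
  have s₀ : ∀ {a b c d a' b' : ℝ}, a = a' → b = b' → c + a + (d + b) = c + d + (a' + b') := by
    rintro a b c d _ _ rfl rfl; ring
  refine s₀ (Finset.sum_congr rfl fun t ht => ?_)
    (Finset.sum_congr rfl fun i _ => Finset.sum_congr rfl fun t ht => ?_)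
  · rw [r₀ t (Finset.mem_range.1 ht)]; rfl
  · rw [r₁ i t (Finset.mem_range.1 ht)]; rfl

/-- The residuals of a trajectory vanish exactly when its control is the optimal feedback. -/
theorem IsTrajectory.residual_eq_zero_iff (h : IsTrajectory P μ X U) {t : ℕ} (ht : t < M.N) :
    (commonResidual P μ t (X t) (U t) = 0 ∧ ∀ i, localResidual P μ i t (X t) (U t) = 0) ↔
      U t = feedback P μ t (X t) := by
  constructor
  · rintro ⟨h0, hi⟩
    funext ⟨j, a⟩
    have e0 := congrFun h0 ⟨j, a⟩
    simp only [commonResidual, Pi.add_apply, Pi.zero_apply] at e0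
    induction j using Fin.cases with
    | zero =>
      rw [Submodule.starProjection_eq_self_iff.2
        (commonSpace_mono P μ ht.le (h.major t ht a))] at e0
      simp only [feedback, Fin.cases_zero, Pi.zero_apply, sub_zero]
      exact eq_neg_of_add_eq_zero_left e0
    | succ i =>
      have e1 := congrFun (hi i) a
      simp only [localResidual, Pi.add_apply, Pi.zero_apply] at e1
      simp only [feedback, Fin.cases_succ]
      rw [← eq_neg_of_add_eq_zero_left e0, sub_eq_add_neg, ← eq_neg_of_add_eq_zero_left e1]
      abel
  · intro hU
    have hc : ∀ p, act (M.Lc t) (fun q => (commonSpace P μ t).starProjection (X t q)) p ∈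
        commonSpace P μ t := act_mem _ fun q => Submodule.starProjection_apply_mem _ _
    have hl : ∀ (i : Fin n) (a), act (M.Ll i t) (fun b =>
        (localSpace P μ i (t + 1)).starProjection (X t ⟨i.succ, b⟩)) a ∈
        localSpace P μ i (t + 1) := fun i => act_mem _ fun b =>
      Submodule.starProjection_apply_mem _ _
    have hp : ∀ p, commonProj P μ (U t p) =
        -act (M.Lc t) (fun q => (commonSpace P μ t).starProjection (X t q)) p := by
      rintro ⟨j, a⟩
      rw [hU, feedback]
      induction j using Fin.cases with
      | zero =>
        simp only [Fin.cases_zero, Pi.zero_apply, sub_zero]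
        exact Submodule.starProjection_eq_self_iff.2
          (commonSpace_mono P μ ht.le (neg_mem (hc _)))
      | succ i =>
        simp only [Fin.cases_succ]
        rw [sub_eq_add_neg, commonProj_minor hP ht i (neg_mem (hc _)) (neg_mem (hl i a))]
    refine ⟨funext fun p => ?_, fun i => funext fun a => ?_⟩
    · simp [commonResidual, hp]
    · simp only [localResidual, Pi.add_apply, hp]
      rw [hU]
      simp only [feedback, Fin.cases_succ, Pi.zero_apply]
      abel

theorem feedback_major_mem (t : ℕ) (x : Stacked M.dx → Lp ℝ 2 μ) (a : Fin (M.du 0)) :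
    feedback P μ t x ⟨0, a⟩ ∈ commonSpace P μ t := by
  simp only [feedback, Fin.cases_zero, Pi.zero_apply, sub_zero]
  exact neg_mem (act_mem _ (fun q => Submodule.starProjection_apply_mem _ _) _)

theorem feedback_minor_mem (t : ℕ) (x : Stacked M.dx → Lp ℝ 2 μ) (i : Fin n)
    (a : Fin (M.du i.succ)) :
    feedback P μ t x ⟨i.succ, a⟩ ∈ commonSpace P μ t ⊔ localSpace P μ i (t + 1) := by
  simp only [feedback, Fin.cases_succ]
  refine sub_mem (le_sup_left (a := commonSpace P μ t) ?_)
    (le_sup_right (a := commonSpace P μ t) ?_)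
  · exact neg_mem (act_mem _ (fun q => Submodule.starProjection_apply_mem _ _) _)
  · exact act_mem _ (fun q => Submodule.starProjection_apply_mem _ _) _

end Trajectories

end MajorMinor

namespace MajorMinor

variable {n : ℕ} {Ω : Type*} [MeasurableSpace Ω]

/-! ### Affine strategies and their trajectories -/

section Strategies

variable {M : Model n} (P : Noise M Ω) (μ : Measure Ω)

/-- The class of the state. -/
def stateL2 (u : Control M Ω) (t : ℕ) (p : Stacked M.dx) : Lp ℝ 2 μ :=
  toL2 μ fun ω => state P u t ω p

/-- The class of the control. -/
def controlL2 (u : Control M Ω) (t : ℕ) (p : Stacked M.du) : Lp ℝ 2 μ :=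
  toL2 μ fun ω => u t ω p

variable {μ}

theorem integrable_quadratic {ι : Type*} [Fintype ι] (S : Matrix ι ι ℝ) {x : Ω → ι → ℝ}
    (hx : ∀ p, (fun ω => x ω p) ∈ memLpTwo μ) :
    Integrable (fun ω => x ω ⬝ᵥ S *ᵥ x ω) μ ∧
      ∫ ω, x ω ⬝ᵥ S *ᵥ x ω ∂μ =
        ip (fun p => toL2 μ fun ω => x ω p) (act S fun p => toL2 μ fun ω => x ω p) := by
  have hS : ∀ p, (fun ω => (S *ᵥ x ω) p) ∈ memLpTwo μ := fun p => by
    rw [coord_mulVec]; exact act_mem S hx p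
  have hi : ∀ p ∈ Finset.univ, Integrable (fun ω => x ω p * (S *ᵥ x ω) p) μ := fun p _ =>
    MemLp.integrable_mul (hx p) (hS p)
  refine ⟨integrable_finsetSum _ hi, ?_⟩
  simp only [dotProduct]
  rw [integral_finsetSum _ hi, ip]
  refine Finset.sum_congr rfl fun p _ => ?_
  rw [← inner_toL2 (hx p) (hS p), coord_mulVec, toL2_act S hx]

variable {P} [IsProbabilityMeasure μ] (hP : P.Admissible μ) (g : AffineStrategy M)

include hP

theorem control_memLpTwo {t : ℕ} (ht : t ≤ M.N) (p : Stacked M.du) :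
    (fun ω => g.control P t ω p) ∈ memLpTwo μ := by
  obtain ⟨j, a⟩ := p
  induction j using Fin.cases with
  | zero => exact majorSpan_le_memLpTwo hP (by omega) ((major_mem_majorSpan P g t).2 a)
  | succ i =>
    have h : minorSpan P i t (t + 1) ≤ memLpTwo μ :=
      sup_le (majorSpan_le_memLpTwo hP (by omega)) (minorPrim_le_memLpTwo hP i (by omega))
    exact h ((minor_mem_minorSpan P g i t).2.2 a)

theorem init_memLpTwo (p : Stacked M.dx) : (fun ω => P.x₁ ω p) ∈ memLpTwo μ :=
  agentPrim_le_memLpTwo hP p.1 (init_mem_agentPrim P p.1 p.2)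

theorem noise_memLpTwo {t : ℕ} (ht : t ≤ M.N) (p : Stacked M.dx) :
    (fun ω => P.W t ω p) ∈ memLpTwo μ :=
  agentPrim_le_memLpTwo hP p.1 (w_mem_agentPrim P p.1 ht p.2)

theorem state_memLpTwo {t : ℕ} (ht : t ≤ M.N) (p : Stacked M.dx) :
    (fun ω => state P (g.control P) t ω p) ∈ memLpTwo μ := by
  induction t generalizing p with
  | zero => exact init_memLpTwo hP p
  | succ t ih =>
    rw [coord_state_succ]
    exact add_mem (add_mem (act_mem _ (fun q => ih (by omega) q) p)
      (act_mem _ (fun q => control_memLpTwo hP g (by omega) q) p)) (noise_memLpTwo hP (by omega) p)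

theorem toL2_mem_sup_of_mem_minorSpan {i : Fin n} {t s : ℕ} (ht : t ≤ M.N + 1)
    (hs : s ≤ M.N + 1) {f : Ω → ℝ} (hf : f ∈ minorSpan P i t s) :
    toL2 μ f ∈ commonSpace P μ t ⊔ localSpace P μ i s := by
  obtain ⟨f₁, h₁, f₂, h₂, rfl⟩ := Submodule.mem_sup.1 hf
  rw [toL2_add (majorSpan_le_memLpTwo hP ht h₁) (minorPrim_le_memLpTwo hP i hs h₂)]
  exact add_mem (le_sup_left (a := commonSpace P μ t)
    (toL2_mem_spanL2 (majorSpan_le_memLpTwo hP ht) h₁))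
    (le_sup_right (a := commonSpace P μ t) (toL2_mem_spanL2 (minorPrim_le_memLpTwo hP i hs) h₂))

theorem exists_mem_minorSpan {i : Fin n} {t s : ℕ} (ht : t ≤ M.N + 1) (hs : s ≤ M.N + 1)
    {x : Lp ℝ 2 μ} (hx : x ∈ commonSpace P μ t ⊔ localSpace P μ i s) :
    ∃ f ∈ minorSpan P i t s, toL2 μ f = x := by
  obtain ⟨x₁, h₁, x₂, h₂, rfl⟩ := Submodule.mem_sup.1 hx
  obtain ⟨f₁, hf₁, rfl⟩ := exists_mem_funSpan (majorSpan_le_memLpTwo hP ht) h₁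
  obtain ⟨f₂, hf₂, rfl⟩ := exists_mem_funSpan (minorPrim_le_memLpTwo hP i hs) h₂
  exact ⟨f₁ + f₂, Submodule.add_mem_sup hf₁ hf₂,
    toL2_add (majorSpan_le_memLpTwo hP ht hf₁) (minorPrim_le_memLpTwo hP i hs hf₂)⟩

theorem isTrajectory : IsTrajectory P μ (stateL2 P μ (g.control P)) (controlL2 μ (g.control P))
    where
  init := rfl
  step t ht := by
    funext p
    have hs := state_memLpTwo hP g ht.le
    have hu := control_memLpTwo hP g ht.le
    simp only [stateL2]
    rw [coord_state_succ, toL2_add (add_mem (act_mem _ hs p) (act_mem _ hu p))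
      (noise_memLpTwo hP ht.le p), toL2_add (act_mem _ hs p) (act_mem _ hu p),
      toL2_act _ hs, toL2_act _ hu]
    rfl
  major t ht a := toL2_mem_spanL2 (majorSpan_le_memLpTwo hP (by omega))
    ((major_mem_majorSpan P g t).2 a)
  minor t ht i a := toL2_mem_sup_of_mem_minorSpan hP (by omega) (by omega)
    ((minor_mem_minorSpan P g i t).2.2 a)

theorem integrable_pathCost : Integrable (pathCost P (g.control P)) μ ∧
    g.cost P μ = quadCost M.N M.Q M.QT M.R (stateL2 P μ (g.control P))
      (controlL2 μ (g.control P)) := by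
  have hx := fun (S : Matrix (Stacked M.dx) (Stacked M.dx) ℝ) t (ht : t ≤ M.N) =>
    integrable_quadratic S (state_memLpTwo hP g ht)
  have hu := fun t (ht : t ≤ M.N) => integrable_quadratic M.R (control_memLpTwo hP g ht)
  have hs : ∀ t ∈ Finset.range M.N, Integrable (fun ω =>
      state P (g.control P) t ω ⬝ᵥ M.Q *ᵥ state P (g.control P) t ω +
        g.control P t ω ⬝ᵥ M.R *ᵥ g.control P t ω) μ := fun t ht =>
    (hx M.Q t (Finset.mem_range.1 ht).le).1.add (hu t (Finset.mem_range.1 ht).le).1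
  have hsum := integrable_finsetSum _ hs
  refine ⟨hsum.add (hx M.QT M.N le_rfl).1, ?_⟩
  rw [AffineStrategy.cost, quadCost]
  simp only [pathCost]
  rw [integral_add hsum (hx M.QT M.N le_rfl).1, integral_finsetSum _ hs,
    (hx M.QT M.N le_rfl).2]
  congr 1
  refine Finset.sum_congr rfl fun t ht => ?_
  have ht' := (Finset.mem_range.1 ht).le
  rw [integral_add (hx M.Q t ht').1 (hu t ht').1, (hx M.Q t ht').2, (hu t ht').2]
  rfl

/-- A strategy that generates the optimal feedback. -/
def IsFeedback (P : Noise M Ω) (μ : Measure Ω) (g : AffineStrategy M) (t : ℕ) : Prop :=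
  controlL2 μ (g.control P) t = feedback P μ t (stateL2 P μ (g.control P) t)

/-- The state process under the optimal feedback. -/
def optimalState (P : Noise M Ω) (μ : Measure Ω) : ℕ → Stacked M.dx → Lp ℝ 2 μ
  | 0 => initL2 P μ
  | t + 1 => act M.A (optimalState P μ t) + act M.B (feedback P μ t (optimalState P μ t)) +
      noiseL2 P μ t

/-- Feedback and dynamics form a closed recursion in $L^2$ that no longer refers to the strategy.
Uniqueness of the optimal controls rests on this. -/
theorem stateL2_eq_optimalState {g : AffineStrategy M} {t : ℕ} (ht : t ≤ M.N)
    (h : ∀ s < t, controlL2 μ (g.control P) s = feedback P μ s (optimalState P μ s)) :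
    stateL2 P μ (g.control P) t = optimalState P μ t := by
  induction t with
  | zero => rfl
  | succ t ih =>
    rw [(isTrajectory hP g).step t (by omega), ih (by omega) fun s hs => h s (by omega),
      h t (by omega)]
    rfl

theorem controlL2_eq_of_isFeedback {g : AffineStrategy M} {t : ℕ} (ht : t < M.N)
    (h : ∀ s ≤ t, IsFeedback P μ g s) :
    controlL2 μ (g.control P) t = feedback P μ t (optimalState P μ t) := by
  induction t using Nat.strong_induction_on with
  | _ t ih =>
    rw [h t le_rfl, stateL2_eq_optimalState hP ht.le fun s hs =>
      ih s hs (by omega) fun r hr => h r (by omega)]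

theorem exists_isFeedback : ∃ g : AffineStrategy M, ∀ t < M.N, IsFeedback P μ g t := by
  -- The optimal controls are first computed as fixed elements of $L^2$, and representatives are
  -- chosen inside the control-free spans. From time `M.N` on, where nothing is required, the
  -- representative is `0`.
  have h0 : ∀ (t : ℕ) (a : Fin (M.du 0)), ∃ f ∈ majorSpan P t, t < M.N →
      toL2 μ f = feedback P μ t (optimalState P μ t) ⟨0, a⟩ := fun t a => by
    by_cases ht : t < M.N
    · obtain ⟨f, hf, e⟩ := exists_mem_funSpan (majorSpan_le_memLpTwo hP (by omega))
        (feedback_major_mem hP t (optimalState P μ t) a)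
      exact ⟨f, hf, fun _ => e⟩
    · exact ⟨0, zero_mem _, fun h => absurd h ht⟩
  have h1 : ∀ (i : Fin n) (t : ℕ) (a : Fin (M.du i.succ)), ∃ f ∈ minorSpan P i t (t + 1),
      t < M.N → toL2 μ f = feedback P μ t (optimalState P μ t) ⟨i.succ, a⟩ := fun i t a => by
    by_cases ht : t < M.N
    · obtain ⟨f, hf, e⟩ := exists_mem_minorSpan hP (by omega) (by omega)
        (feedback_minor_mem hP t (optimalState P μ t) i a)
      exact ⟨f, hf, fun _ => e⟩
    · exact ⟨0, zero_mem _, fun h => absurd h ht⟩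
  choose φ hφ eφ using h0
  choose ψ hψ eψ using h1
  obtain ⟨g, hg⟩ := exists_strategy P (fun t ω p =>
    Fin.cases (motive := fun j => Fin (M.du j) → ℝ) (fun a => φ t a ω)
      (fun i a => ψ i t a ω) p.1 p.2) hφ hψ
  refine ⟨g, fun t ht => ?_⟩
  have hc : ∀ s < M.N, controlL2 μ (g.control P) s = feedback P μ s (optimalState P μ s) := by
    intro s hs
    funext ⟨j, a⟩
    rw [controlL2, hg]
    induction j using Fin.cases with
    | zero => exact eφ s a hs
    | succ i => exact eψ i s a hs
  rw [IsFeedback, hc t ht, stateL2_eq_optimalState hP ht.le fun s hs => hc s (by omega)]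

theorem isOptimal_iff : g.IsOptimal P μ ↔ ∀ t < M.N, IsFeedback P μ g t := by
  obtain ⟨c, hc⟩ := exists_quadCost_eq hP
  have hposc : ∀ t, (M.R + M.Bᵀ * M.Sc (t + 1) * M.B).PosDef := fun t =>
    posDef_innovation (posSemidef_riccatiSol _ _ M.Q_posSemidef M.QT_posSemidef M.R_posDef _) _
      M.R_posDef
  have hposl : ∀ (i : Fin n) t, (diagBlock M.R i.succ +
      (diagBlock M.B i.succ)ᵀ * M.Sl i (t + 1) * diagBlock M.B i.succ).PosDef := fun i t =>
    posDef_innovation (posSemidef_riccatiSol _ _ (diagBlock_posSemidef M.Q_posSemidef _)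
      (diagBlock_posSemidef M.QT_posSemidef _) (diagBlock_posDef M.R_posDef _) _) _
      (diagBlock_posDef M.R_posDef _)
  have hcost : ∀ g : AffineStrategy M, _ := fun g =>
    (integrable_pathCost hP g).2.trans (hc _ _ (isTrajectory hP g))
  have hnc := fun (g : AffineStrategy M) t => quad_nonneg (hposc t).posSemidef
    (commonResidual P μ t (stateL2 P μ (g.control P) t) (controlL2 μ (g.control P) t))
  have hnl := fun (g : AffineStrategy M) i t => quad_nonneg (hposl i t).posSemidef
    (localResidual P μ i t (stateL2 P μ (g.control P) t) (controlL2 μ (g.control P) t))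
  have hge : ∀ g : AffineStrategy M, c ≤ g.cost P μ := fun g => by
    rw [hcost g]
    exact le_add_of_nonneg_right (add_nonneg (Finset.sum_nonneg fun t _ => hnc g t)
      (Finset.sum_nonneg fun i _ => Finset.sum_nonneg fun t _ => hnl g i t))
  have heq : ∀ g : AffineStrategy M, g.cost P μ = c ↔ ∀ t < M.N, IsFeedback P μ g t := by
    intro g
    rw [hcost g, add_eq_left, add_eq_zero_iff_of_nonneg (Finset.sum_nonneg fun t _ => hnc g t)
      (Finset.sum_nonneg fun i _ => Finset.sum_nonneg fun t _ => hnl g i t),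
      Finset.sum_eq_zero_iff_of_nonneg fun t _ => hnc g t,
      Finset.sum_eq_zero_iff_of_nonneg fun i _ => Finset.sum_nonneg fun t _ => hnl g i t]
    simp only [Finset.sum_eq_zero_iff_of_nonneg fun t _ => hnl g _ t, Finset.mem_univ,
      Finset.mem_range, true_implies]
    constructor
    · rintro ⟨h0, hi⟩ t ht
      exact ((isTrajectory hP g).residual_eq_zero_iff hP ht).1
        ⟨eq_zero_of_quad (hposc t) (h0 t ht), fun i => eq_zero_of_quad (hposl i t) (hi i t ht)⟩
    · intro h
      have hr := fun t ht => ((isTrajectory hP g).residual_eq_zero_iff hP ht).2 (h t ht)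
      refine ⟨fun t ht => ?_, fun i t ht => ?_⟩
      · rw [(hr t ht).1]; simp [ip]
      · rw [(hr t ht).2 i]; simp [ip]
  obtain ⟨g₀, hg₀⟩ := exists_isFeedback hP
  rw [← heq g]
  -- The lower bound `c` is attained by `g₀`, so optimality means cost exactly `c`.
  exact ⟨fun h => le_antisymm ((h g₀).trans_eq ((heq g₀).2 hg₀)) (hge g),
    fun h g' => h.trans_le (hge g')⟩

end Strategies

end MajorMinor

namespace MajorMinor

variable {n : ℕ} {Ω : Type*} [MeasurableSpace Ω]

/-! ### The gain form -/

section Classes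

variable {μ : Measure Ω}

theorem coeFn_memLpTwo (x : Lp ℝ 2 μ) : (fun ω => x ω) ∈ memLpTwo μ := Lp.memLp x

theorem toL2_coeFn (x : Lp ℝ 2 μ) : toL2 μ (fun ω => x ω) = x := by
  rw [toL2_eq_toLp (coeFn_memLpTwo x)]
  exact Lp.toLp_coeFn x (Lp.memLp x)

theorem ae_eq_iff_toL2 {ι : Type*} [Countable ι] {f h : Ω → ι → ℝ}
    (hf : ∀ p, (fun ω => f ω p) ∈ memLpTwo μ) (hh : ∀ p, (fun ω => h ω p) ∈ memLpTwo μ) :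
    (∀ᵐ ω ∂μ, f ω = h ω) ↔ ∀ p, (toL2 μ fun ω => f ω p) = toL2 μ fun ω => h ω p := by
  simp only [funext_iff, ae_all_iff, toL2_eq_iff (hf _) (hh _)]
  rfl

theorem ae_eq_neg_mulVec_iff {a b : Type*} [Fintype a] [Fintype b] (L : Matrix a b ℝ)
    {f : Ω → a → ℝ} (hf : ∀ p, (fun ω => f ω p) ∈ memLpTwo μ) {z : Ω → b → ℝ}
    (hz : ∀ q, (fun ω => z ω q) ∈ memLpTwo μ) :
    (∀ᵐ ω ∂μ, f ω = -(L *ᵥ z ω)) ↔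
      (fun p => toL2 μ fun ω => f ω p) + act L (fun q => toL2 μ fun ω => z ω q) = 0 := by
  have h1 : ∀ p, (fun ω => (-(L *ᵥ z ω)) p) = (-1 : ℝ) • act L (fun q ω => z ω q) p := fun p => by
    rw [← coord_mulVec]; funext ω; simp
  have h2 : ∀ p, (fun ω => (-(L *ᵥ z ω)) p) ∈ memLpTwo μ := fun p => by
    rw [h1]; exact Submodule.smul_mem _ _ (act_mem L hz p)
  rw [ae_eq_iff_toL2 hf h2, funext_iff]
  refine forall_congr' fun p => ?_
  rw [h1, toL2_smul _ (act_mem L hz p), toL2_act L hz, neg_one_smul, Pi.add_apply, Pi.zero_apply,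
    eq_neg_iff_add_eq_zero]

end Classes

/-! ### Common and local parts of the closed loop -/

section Splitting

variable {M : Model n} {P : Noise M Ω} {μ : Measure Ω} [IsProbabilityMeasure μ]
  (hP : P.Admissible μ) (g : AffineStrategy M)

theorem state_eq_split (u : Control M Ω) (t : ℕ) (ω : Ω) :
    state P u t ω = commonState P μ u t ω + localState P μ u t ω + stochState P t ω := by
  induction t with
  | zero => simp [state, commonState, localState, stochState]
  | succ t ih =>
    have hu : u t ω = commonControl P μ u t ω + localControl P μ u t ω := by
      simp [localControl]
    rw [state, commonState, localState, stochState, ih, hu]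
    simp only [Matrix.mulVec_add]
    abel

include hP

/-- The common control is the projection of the control onto the affine functions of the primitive
random variables of the major agent. -/
theorem commonControl_toL2 {t : ℕ} (ht : t < M.N) (p : Stacked M.du) :
    (fun ω => commonControl P μ (g.control P) t ω p) ∈ memLpTwo μ ∧
      (toL2 μ fun ω => commonControl P μ (g.control P) t ω p) =
        commonProj P μ (controlL2 μ (g.control P) t p) := by
  have key : ∃ f ∈ majorSpan P t, (fun ω => commonControl P μ (g.control P) t ω p) =ᵐ[μ] f ∧
      commonProj P μ (controlL2 μ (g.control P) t p) = toL2 μ f := by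
    obtain ⟨j, a⟩ := p
    induction j using Fin.cases with
    | zero =>
      have hf := (major_mem_majorSpan P g t).2 a
      refine ⟨_, hf, condExp_majorSpan P hP g ht.le hf, ?_⟩
      exact Submodule.starProjection_eq_self_iff.2
        (commonSpace_mono P μ ht.le ((isTrajectory hP g).major t ht a))
    | succ i =>
      obtain ⟨f, hf, k, hk, e⟩ := Submodule.mem_sup.1 ((minor_mem_minorSpan P g i t).2.2 a)
      refine ⟨f, hf, ?_, ?_⟩
      · have := condExp_add_minorPrim P hP g ht.le i hf hk
        rw [e] at this
        exact this
      · have hfm := majorSpan_le_memLpTwo hP (t := t) (by omega)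
        have hkm := minorPrim_le_memLpTwo hP i (t := t + 1) (by omega)
        rw [controlL2, ← e, toL2_add (hfm hf) (hkm hk)]
        exact commonProj_minor hP ht i (toL2_mem_spanL2 hfm hf) (toL2_mem_spanL2 hkm hk)
  obtain ⟨f, hf, hae, e⟩ := key
  refine ⟨?_, ?_⟩
  · exact (memLp_congr_ae hae).2 (majorSpan_le_memLpTwo hP (by omega) hf)
  · rw [e, toL2_congr hae]

theorem localControl_toL2 {t : ℕ} (ht : t < M.N) (p : Stacked M.du) :
    (fun ω => localControl P μ (g.control P) t ω p) ∈ memLpTwo μ ∧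
      (toL2 μ fun ω => localControl P μ (g.control P) t ω p) =
        controlL2 μ (g.control P) t p - commonProj P μ (controlL2 μ (g.control P) t p) := by
  have hc := commonControl_toL2 hP g ht p
  have hu := control_memLpTwo hP g ht.le p
  refine ⟨sub_mem hu hc.1, ?_⟩
  rw [← hc.2]
  exact toL2_sub hu hc.1

/-- $x^c$ is driven by projected controls alone and $x^\ell$ by their residuals, so the two stay on
opposite sides of one fixed orthogonal decomposition, that of the final common space. -/
theorem commonState_toL2 {t : ℕ} (ht : t ≤ M.N) (p : Stacked M.dx) :
    (fun ω => commonState P μ (g.control P) t ω p) ∈ memLpTwo μ ∧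
      (toL2 μ fun ω => commonState P μ (g.control P) t ω p) ∈ commonSpace P μ M.N := by
  induction t generalizing p with
  | zero =>
    have h : (fun ω => commonState P μ (g.control P) 0 ω p) = 0 := rfl
    rw [h]
    refine ⟨zero_mem _, ?_⟩
    rw [show toL2 μ (0 : Ω → ℝ) = 0 from map_zero (toL2Lin μ)]
    exact zero_mem _
  | succ t ih =>
    have h : (fun ω => commonState P μ (g.control P) (t + 1) ω p) =
        act M.A (fun q ω => commonState P μ (g.control P) t ω q) p +
          act M.B (fun q ω => commonControl P μ (g.control P) t ω q) p := by
      rw [← coord_mulVec, ← coord_mulVec]; rfl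
    have hx := fun q => ih (by omega) q
    have hc := fun q => commonControl_toL2 hP g (show t < M.N by omega) q
    rw [h, toL2_add (act_mem _ (fun q => (hx q).1) p) (act_mem _ (fun q => (hc q).1) p),
      toL2_act _ fun q => (hx q).1, toL2_act _ fun q => (hc q).1]
    refine ⟨add_mem (act_mem _ (fun q => (hx q).1) p) (act_mem _ (fun q => (hc q).1) p),
      add_mem (act_mem _ (fun q => (hx q).2) p) (act_mem _ (fun q => ?_) p)⟩
    rw [(hc q).2]
    exact Submodule.starProjection_apply_mem _ _

theorem localState_toL2 {t : ℕ} (ht : t ≤ M.N) (p : Stacked M.dx) :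
    (fun ω => localState P μ (g.control P) t ω p) ∈ memLpTwo μ ∧
      (toL2 μ fun ω => localState P μ (g.control P) t ω p) ∈ (commonSpace P μ M.N)ᗮ := by
  induction t generalizing p with
  | zero =>
    have h : (fun ω => localState P μ (g.control P) 0 ω p) = 0 := rfl
    rw [h]
    refine ⟨zero_mem _, ?_⟩
    rw [show toL2 μ (0 : Ω → ℝ) = 0 from map_zero (toL2Lin μ)]
    exact zero_mem _
  | succ t ih =>
    have h : (fun ω => localState P μ (g.control P) (t + 1) ω p) =
        act M.A (fun q ω => localState P μ (g.control P) t ω q) p +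
          act M.B (fun q ω => localControl P μ (g.control P) t ω q) p := by
      rw [← coord_mulVec, ← coord_mulVec]; rfl
    have hx := fun q => ih (by omega) q
    have hc := fun q => localControl_toL2 hP g (show t < M.N by omega) q
    rw [h, toL2_add (act_mem _ (fun q => (hx q).1) p) (act_mem _ (fun q => (hc q).1) p),
      toL2_act _ fun q => (hx q).1, toL2_act _ fun q => (hc q).1]
    refine ⟨add_mem (act_mem _ (fun q => (hx q).1) p) (act_mem _ (fun q => (hc q).1) p),
      add_mem (act_mem _ (fun q => (hx q).2) p) (act_mem _ (fun q => ?_) p)⟩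
    rw [(hc q).2]
    exact Submodule.sub_starProjection_mem_orthogonal _

/-- $x-z^c=x^\ell$ is orthogonal to the common space, so $z^c$ and $x$ have the same common
estimate. -/
theorem zc_toL2 {t : ℕ} (ht : t ≤ M.N) (p : Stacked M.dx) :
    stateL2 P μ (g.control P) t p - (toL2 μ fun ω => zc P μ (g.control P) t ω p) ∈
      (commonSpace P μ M.N)ᗮ := by
  have hl := localState_toL2 hP g ht p
  have hs := state_memLpTwo hP g ht p
  have h : (fun ω => zc P μ (g.control P) t ω p) =
      (fun ω => state P (g.control P) t ω p) -
        fun ω => localState P μ (g.control P) t ω p := by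
    funext ω
    rw [Pi.sub_apply, state_eq_split (μ := μ)]
    simp only [zc, Pi.add_apply]; ring
  rw [h, toL2_sub hs hl.1, stateL2, sub_sub_cancel]
  exact hl.2

/-- $x_i-z^\ell_i=x^c_i$ is common, hence invisible to projections onto the local space. -/
theorem zl_toL2 {t : ℕ} (ht : t ≤ M.N) (i : Fin n) (a : Fin (M.dx i.succ)) :
    stateL2 P μ (g.control P) t ⟨i.succ, a⟩ - (toL2 μ fun ω => zl P μ (g.control P) i t ω a) ∈
      commonSpace P μ M.N := by
  have hc := commonState_toL2 hP g ht ⟨i.succ, a⟩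
  have hs := state_memLpTwo hP g ht ⟨i.succ, a⟩
  have h : (fun ω => zl P μ (g.control P) i t ω a) =
      (fun ω => state P (g.control P) t ω ⟨i.succ, a⟩) -
        fun ω => commonState P μ (g.control P) t ω ⟨i.succ, a⟩ := by
    funext ω
    rw [Pi.sub_apply, state_eq_split (μ := μ)]
    simp only [zl, Pi.add_apply]; ring
  rw [h, toL2_sub hs hc.1, stateL2, sub_sub_cancel]
  exact hc.2

end Splitting

/-! ### Linear spans of the information and the LLMS estimates -/

section GainForm

variable {M : Model n} (P : Noise M Ω) (μ : Measure Ω)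

/-- The square integrable classes with zero mean. -/
abbrev meanZero : Submodule ℝ (Lp ℝ 2 μ) := (ℝ ∙ toL2 μ fun _ : Ω => (1 : ℝ))ᗮ

/-- Classes of linear functions of the primitive random variables of the major agent before `t`. -/
abbrev majorSpace (t : ℕ) : Submodule ℝ (Lp ℝ 2 μ) := spanL2 μ (majorPrim P t)

theorem majorSpace_le_commonSpace (t : ℕ) : majorSpace P μ t ≤ commonSpace P μ t := by
  refine Submodule.span_le.2 ?_
  rintro _ ⟨k, rfl⟩
  exact Submodule.subset_span ⟨some k, rfl⟩

theorem commonSpace_le_sup (t : ℕ) :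
    commonSpace P μ t ≤ (ℝ ∙ toL2 μ fun _ : Ω => (1 : ℝ)) ⊔ majorSpace P μ t := by
  refine Submodule.span_le.2 ?_
  rintro _ ⟨_ | k, rfl⟩
  · exact le_sup_left (b := majorSpace P μ t) (Submodule.mem_span_singleton_self _)
  · exact le_sup_right (b := majorSpace P μ t) (Submodule.subset_span ⟨k, rfl⟩)

variable {P μ} [IsProbabilityMeasure μ] (hP : P.Admissible μ)

include hP

theorem agentSpace_le_meanZero (j : Fin (n + 1)) : agentSpace P μ j ≤ meanZero μ := fun _ hx =>
  Submodule.mem_orthogonal_singleton_iff_inner_right.2 (inner_one_of_mem_agentPrim hP hx)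

theorem majorSpace_le_meanZero {t : ℕ} (ht : t ≤ M.N + 1) : majorSpace P μ t ≤ meanZero μ :=
  (spanL2_mono (agentPrim_le_memLpTwo hP 0) (majorPrim_le_agentPrim P ht)).trans
    (agentSpace_le_meanZero hP 0)

theorem localSpace_le_meanZero (i : Fin n) {t : ℕ} (ht : t ≤ M.N + 1) :
    localSpace P μ i t ≤ meanZero μ :=
  (localSpace_le_agentSpace hP i ht).trans (agentSpace_le_meanZero hP _)

/-- The primitives have zero mean, so the constant component of an element of `commonSpace` is its
mean. This is how affine spans are compared with the linear spans $H_0$ and $H_i$. -/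
theorem mem_majorSpace_of_meanZero {t : ℕ} (ht : t ≤ M.N + 1) {x : Lp ℝ 2 μ}
    (hx : x ∈ commonSpace P μ t) (h0 : x ∈ meanZero μ) : x ∈ majorSpace P μ t := by
  obtain ⟨y, hy, f, hf, rfl⟩ := Submodule.mem_sup.1 (commonSpace_le_sup P μ t hx)
  have hy0 : y ∈ meanZero μ := by
    have := sub_mem h0 (majorSpace_le_meanZero hP ht hf)
    simpa using this
  have : y = 0 := inner_self_eq_zero.1 (Submodule.inner_right_of_mem_orthogonal hy hy0)
  rw [this, zero_add]
  exact hf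

theorem mem_sup_of_meanZero {t s : ℕ} (ht : t ≤ M.N + 1) (hs : s ≤ M.N + 1) {i : Fin n}
    {x : Lp ℝ 2 μ} (hx : x ∈ commonSpace P μ t ⊔ localSpace P μ i s) (h0 : x ∈ meanZero μ) :
    x ∈ majorSpace P μ t ⊔ localSpace P μ i s := by
  obtain ⟨f, hf, k, hk, rfl⟩ := Submodule.mem_sup.1 hx
  refine Submodule.add_mem_sup (mem_majorSpace_of_meanZero hP ht hf ?_) hk
  have := sub_mem h0 (localSpace_le_meanZero hP i hs hk)
  simpa using this

theorem feedback_mem_meanZero {t : ℕ} (ht : t < M.N) {x : Stacked M.dx → Lp ℝ 2 μ}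
    (hx : ∀ p, x p ∈ meanZero μ) (p : Stacked M.du) : feedback P μ t x p ∈ meanZero μ := by
  -- A self-adjoint projection that fixes the constant `1` preserves means.
  have hc : ∀ q, (commonSpace P μ t).starProjection (x q) ∈ meanZero μ := fun q => by
    refine Submodule.mem_orthogonal_singleton_iff_inner_right.2 ?_
    rw [← Submodule.inner_starProjection_left_eq_right,
      Submodule.starProjection_eq_self_iff.2 (one_mem_commonSpace P μ t)]
    exact Submodule.mem_orthogonal_singleton_iff_inner_right.1 (hx q)
  refine sub_mem (neg_mem (act_mem _ hc p)) ?_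
  obtain ⟨j, a⟩ := p
  induction j using Fin.cases with
  | zero => exact zero_mem _
  | succ i =>
    exact act_mem _ (fun b => localSpace_le_meanZero hP i (t := t + 1) (by omega)
      (Submodule.starProjection_apply_mem _ _)) a

variable {g : AffineStrategy M} {t : ℕ} (ht : t < M.N) (hg : ∀ s < t, IsFeedback P μ g s)

include ht hg

/-- The feedback is linear without offset and the primitives are centred, so means remain zero along
the recursion. -/
theorem meanZero_of_isFeedback :
    (∀ s ≤ t, ∀ p, stateL2 P μ (g.control P) s p ∈ meanZero μ) ∧
      ∀ s < t, ∀ p, controlL2 μ (g.control P) s p ∈ meanZero μ := by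
  have hstate : ∀ s ≤ t, ∀ p, stateL2 P μ (g.control P) s p ∈ meanZero μ := by
    intro s
    induction s with
    | zero =>
      rintro - ⟨j, a⟩
      exact agentSpace_le_meanZero hP j (initL2_mem_agentSpace hP j a)
    | succ s ih =>
      rintro hs ⟨j, a⟩
      rw [(isTrajectory hP g).step s (by omega), hg s (by omega)]
      exact add_mem (add_mem (act_mem _ (ih (by omega)) _)
        (act_mem _ (feedback_mem_meanZero hP (by omega) (ih (by omega))) _))
        (agentSpace_le_meanZero hP j (noiseL2_mem_agentSpace hP (by omega) j a))
  refine ⟨hstate, fun s hs p => ?_⟩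
  rw [hg s hs]
  exact feedback_mem_meanZero hP (by omega) (hstate s hs.le) p

theorem majorInfo_mem_meanZero (k : M.MajorIdx t) :
    (toL2 μ fun ω => majorInfo P (g.control P) t ω k) ∈ meanZero μ := by
  have h := meanZero_of_isFeedback hP ht hg
  rcases k with ⟨s, b⟩ | ⟨s, b⟩
  · exact h.1 s (Nat.lt_succ_iff.1 s.2) ⟨0, b⟩
  · exact h.2 s s.2 ⟨0, b⟩

theorem minorInfo_mem_meanZero (i : Fin n) (k : M.MinorIdx i t) :
    (toL2 μ fun ω => minorInfo P (g.control P) i t ω k) ∈ meanZero μ := by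
  have h := meanZero_of_isFeedback hP ht hg
  rcases k with k | ⟨s, b⟩ | ⟨s, b⟩
  · exact majorInfo_mem_meanZero hP ht hg k
  · have hs := s.2
    have hx := fun a => state_memLpTwo hP g (t := s) (by omega) ⟨i.succ, a⟩
    have hv := v_mem_agentPrim P i (t := s) (by omega) b
    change (toL2 μ fun ω => output P (g.control P) i s ω b) ∈ meanZero μ
    rw [coord_output, toL2_add (act_mem _ hx b) (agentPrim_le_memLpTwo hP _ hv), toL2_act _ hx]
    exact add_mem (act_mem _ (fun a => h.1 s (by omega) ⟨i.succ, a⟩) b)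
      (agentSpace_le_meanZero hP _ (toL2_mem_spanL2 (agentPrim_le_memLpTwo hP _) hv))
  · exact h.2 s s.2 ⟨i.succ, b⟩

/-- Under the optimal feedback, the information of the major agent spans the same space as the
primitive random variables of the major agent. -/
theorem H0_eq : H0 μ P (g.control P) t = majorSpace P μ t := by
  have hm := majorSpan_le_memLpTwo hP (t := t) (by omega)
  refine le_antisymm (Submodule.span_le.2 ?_) (Submodule.span_le.2 ?_)
  · rintro _ ⟨k, rfl⟩
    exact mem_majorSpace_of_meanZero hP (by omega)
      (toL2_mem_spanL2 hm (majorInfo_mem_majorSpan P g t k))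
      (majorInfo_mem_meanZero hP ht hg k)
  · rintro _ ⟨k, rfl⟩
    refine toL2_mem_spanL2 (funSpan_le_iff.2 fun k => hm (majorInfo_mem_majorSpan P g t k)) ?_
    exact comp_mem_funSpan (majorPrim_mem_majorInfo P t (coord_mem_funSpan (majorPrim P t) k))
      fun ω => (g.control P, ω)

/-- Zero means exclude constants from the information; in the other direction, the control-free
outputs are recovered linearly from it. -/
theorem Hi_eq (i : Fin n) :
    Hi μ P (g.control P) i t = majorSpace P μ t ⊔ localSpace P μ i (t + 1) := by
  have hm : minorSpan P i t (t + 1) ≤ memLpTwo μ :=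
    sup_le (majorSpan_le_memLpTwo hP (by omega)) (minorPrim_le_memLpTwo hP i (by omega))
  have hinfo := (minor_mem_minorSpan P g i t).2.1
  refine le_antisymm (Submodule.span_le.2 ?_) (sup_le ?_ (Submodule.span_le.2 ?_))
  · rintro _ ⟨k, rfl⟩
    exact mem_sup_of_meanZero hP (by omega) (by omega)
      (toL2_mem_sup_of_mem_minorSpan hP (by omega) (by omega) (hinfo k))
      (minorInfo_mem_meanZero hP ht hg i k)
  · rw [← H0_eq hP ht hg]
    exact H0_le_Hi μ P _ i t
  · rintro _ ⟨k, rfl⟩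
    refine toL2_mem_spanL2 (funSpan_le_iff.2 fun k => hm (hinfo k)) ?_
    exact comp_mem_funSpan (minorPrim_mem_minorInfo P i t (coord_mem_funSpan (minorPrim P i _) k))
      fun ω => (g.control P, ω)

/-- The state has zero mean, so its projection onto `commonSpace` already lies in $H_0$; the local
part of the state is orthogonal to both spaces. -/
theorem llms_zc (p : Stacked M.dx) :
    llms μ (H0 μ P (g.control P) t) (fun ω => zc P μ (g.control P) t ω p) =
      (commonSpace P μ t).starProjection (stateL2 P μ (g.control P) t p) := by
  have hH := H0_eq hP ht hg
  have hle : H0 μ P (g.control P) t ≤ commonSpace P μ t := by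
    rw [hH]; exact majorSpace_le_commonSpace P μ t
  refine Submodule.eq_starProjection_of_mem_orthogonal ?_ ?_
  · rw [hH]
    refine mem_majorSpace_of_meanZero hP (by omega) (Submodule.starProjection_apply_mem _ _) ?_
    refine Submodule.mem_orthogonal_singleton_iff_inner_right.2 ?_
    rw [← Submodule.inner_starProjection_left_eq_right,
      Submodule.starProjection_eq_self_iff.2 (one_mem_commonSpace P μ t)]
    exact Submodule.mem_orthogonal_singleton_iff_inner_right.1
      ((meanZero_of_isFeedback hP ht hg).1 t le_rfl p)
  · refine Submodule.orthogonal_le hle ?_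
    have h1 := Submodule.orthogonal_le (commonSpace_mono P μ ht.le) (zc_toL2 hP g ht.le p)
    have h2 := Submodule.sub_starProjection_mem_orthogonal (K := commonSpace P μ t)
      (stateL2 P μ (g.control P) t p)
    have h3 := sub_mem h2 h1
    convert h3 using 1
    abel

/-- $H_i$ is the orthogonal sum of $H_0$ and the local space, so the difference of the two estimates
is the projection onto the local space. -/
theorem llms_zl (i : Fin n) (a : Fin (M.dx i.succ)) :
    llms μ (Hi μ P (g.control P) i t) (fun ω => zl P μ (g.control P) i t ω a) -
        llms μ (H0 μ P (g.control P) t) (fun ω => zl P μ (g.control P) i t ω a) =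
      (localSpace P μ i (t + 1)).starProjection
        (stateL2 P μ (g.control P) t ⟨i.succ, a⟩) := by
  have hH := H0_eq hP ht hg
  have hHi := Hi_eq hP ht hg i
  have hFK : localSpace P μ i (t + 1) ≤ (majorSpace P μ t)ᗮ :=
    (localSpace_le_commonSpace_orthogonal hP i (t := t) (by omega) (by omega)).trans
      (Submodule.orthogonal_le (majorSpace_le_commonSpace P μ t))
  have hKF : majorSpace P μ t ≤ (localSpace P μ i (t + 1))ᗮ :=
    (Submodule.le_orthogonal_orthogonal _).trans (Submodule.orthogonal_le hFK)
  have hNK : commonSpace P μ M.N ≤ (localSpace P μ i (t + 1))ᗮ :=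
    (Submodule.le_orthogonal_orthogonal _).trans (Submodule.orthogonal_le
      (localSpace_le_commonSpace_orthogonal hP i (t := M.N) (by omega) (by omega)))
  rw [starProjection_congr (hNK (zl_toL2 hP g ht.le i a))]
  set z := toL2 μ fun ω => zl P μ (g.control P) i t ω a with hz
  rw [sub_eq_iff_eq_add]
  have hmem : llms μ (H0 μ P (g.control P) t) (fun ω => zl P μ (g.control P) i t ω a) ∈
      majorSpace P μ t := by
    rw [← hH]; exact Submodule.starProjection_apply_mem _ _
  have horth : z - llms μ (H0 μ P (g.control P) t)
      (fun ω => zl P μ (g.control P) i t ω a) ∈ (majorSpace P μ t)ᗮ := by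
    rw [← hH]; exact Submodule.sub_starProjection_mem_orthogonal _
  set y := llms μ (H0 μ P (g.control P) t) (fun ω => zl P μ (g.control P) i t ω a) with hy
  have hk : (localSpace P μ i (t + 1)).starProjection z ∈ localSpace P μ i (t + 1) :=
    Submodule.starProjection_apply_mem _ _
  refine Submodule.eq_starProjection_of_mem_orthogonal ?_ ?_
  · rw [hHi]
    exact add_mem (le_sup_right (a := majorSpace P μ t) hk)
      (le_sup_left (a := majorSpace P μ t) hmem)
  · rw [hHi, ← Submodule.inf_orthogonal]
    refine Submodule.mem_inf.2 ⟨?_, ?_⟩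
    · have := sub_mem horth (hFK hk)
      convert this using 1
      abel
    · have := sub_mem (Submodule.sub_starProjection_mem_orthogonal
        (K := localSpace P μ i (t + 1)) z) (hKF hmem)
      convert this using 1
      abel

/-- If the feedback was optimal before time `t`, then it is optimal at time `t` exactly when the
controls at time `t` have the gain form. -/
theorem gainForm_iff :
    ((∀ᵐ ω ∂μ, commonControl P μ (g.control P) t ω =
        -(M.Lc t *ᵥ zcHat μ P (g.control P) t ω)) ∧
      ∀ i : Fin n, ∀ᵐ ω ∂μ, (fun a => localControl P μ (g.control P) t ω ⟨i.succ, a⟩) =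
        -(M.Ll i t *ᵥ zlHat μ P (g.control P) i t ω)) ↔ IsFeedback P μ g t := by
  rw [IsFeedback, ← (isTrajectory hP g).residual_eq_zero_iff hP ht]
  have hzc : ∀ q, (toL2 μ fun ω => zcHat μ P (g.control P) t ω q) =
      (commonSpace P μ t).starProjection (stateL2 P μ (g.control P) t q) := fun q => by
    rw [← llms_zc hP ht hg q]; exact toL2_coeFn _
  have hzcm : ∀ q, (fun ω => zcHat μ P (g.control P) t ω q) ∈ memLpTwo μ :=
    fun q => coeFn_memLpTwo _
  have hzlm : ∀ (i : Fin n) (a), (fun ω => zlHat μ P (g.control P) i t ω a) ∈ memLpTwo μ :=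
    fun i a => sub_mem (coeFn_memLpTwo _) (coeFn_memLpTwo _)
  have hzl : ∀ (i : Fin n) (a), (toL2 μ fun ω => zlHat μ P (g.control P) i t ω a) =
      (localSpace P μ i (t + 1)).starProjection
        (stateL2 P μ (g.control P) t ⟨i.succ, a⟩) := fun i a => by
    rw [← llms_zl hP ht hg i a]
    refine (toL2_sub (coeFn_memLpTwo _) (coeFn_memLpTwo _)).trans ?_
    rw [toL2_coeFn, toL2_coeFn]
  refine and_congr ?_ (forall_congr' fun i => ?_)
  · rw [ae_eq_neg_mulVec_iff (M.Lc t) (fun p => (commonControl_toL2 hP g ht p).1)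
      hzcm]
    simp only [hzc, (commonControl_toL2 hP g ht _).2]
    rfl
  · rw [ae_eq_neg_mulVec_iff (M.Ll i t) (fun a => (localControl_toL2 hP g ht ⟨i.succ, a⟩).1)
      (hzlm i)]
    simp only [hzl, (localControl_toL2 hP g ht _).2]
    rfl

-- `gainForm_iff` needs optimal feedback at all earlier times. Starting from the gain form, strong
-- induction over time supplies it.
omit ht hg in
theorem hasGainForm_iff (g : AffineStrategy M) :
    g.HasGainForm P μ ↔ ∀ t < M.N, IsFeedback P μ g t := by
  constructor
  · intro h t
    induction t using Nat.strong_induction_on with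
    | _ t ih =>
      intro ht
      exact (gainForm_iff hP ht fun s hs => ih s hs (by omega)).1 (h t ht)
  · intro h t ht
    exact (gainForm_iff hP ht fun s hs => h s (by omega)).2 (h t ht)

end GainForm

end MajorMinor

end

/-- Every affine strategy has a finite cost; a best affine strategy exists; an affine strategy is
best if and only if its common and local controls have the stated form; and any two best affine
strategies generate almost surely the same control actions. -/
theorem mainTheorem4 {n : ℕ} (M : MajorMinor.Model n) {Ω : Type*} [MeasurableSpace Ω]
    (μ : MeasureTheory.Measure Ω) [MeasureTheory.IsProbabilityMeasure μ]
    (P : MajorMinor.Noise M Ω) (hP : P.Admissible μ) :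
    (∀ g : MajorMinor.AffineStrategy M,
      MeasureTheory.Integrable (MajorMinor.pathCost P (g.control P)) μ) ∧
    (∃ g : MajorMinor.AffineStrategy M, g.IsOptimal P μ) ∧
    (∀ g : MajorMinor.AffineStrategy M, g.IsOptimal P μ ↔ g.HasGainForm P μ) ∧
    (∀ g g' : MajorMinor.AffineStrategy M, g.IsOptimal P μ → g'.IsOptimal P μ →
      ∀ t < M.N, ∀ᵐ ω ∂μ, g.control P t ω = g'.control P t ω) := by
  refine ⟨fun g => (MajorMinor.integrable_pathCost hP g).1, ?_, fun g => ?_,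
    fun g g' hg hg' t ht => ?_⟩
  · obtain ⟨g, hg⟩ := MajorMinor.exists_isFeedback hP
    exact ⟨g, (MajorMinor.isOptimal_iff hP g).2 hg⟩
  · rw [MajorMinor.isOptimal_iff hP, MajorMinor.hasGainForm_iff hP]
  · have h := (MajorMinor.isOptimal_iff hP g).1 hg
    have h' := (MajorMinor.isOptimal_iff hP g').1 hg'
    rw [MajorMinor.ae_eq_iff_toL2 (MajorMinor.control_memLpTwo hP g ht.le)
      (MajorMinor.control_memLpTwo hP g' ht.le)]
    intro p
    have e := MajorMinor.controlL2_eq_of_isFeedback hP ht fun s hs => h s (by omega)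
    have e' := MajorMinor.controlL2_eq_of_isFeedback hP ht fun s hs => h' s (by omega)
    exact congrFun (e.trans e'.symm) p
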